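/- Let $(M^2,D,\Omega)$ be a (non-empty) equi-affine $2$-manifold: $M^2$ is an oriented smooth surface, $D$ is a smooth affine connection on $M^2$ (not necessarily torsion free), and $\Omega$ is a smooth non-vanishing, positively oriented $2$-form that is parallel with respect to $D$. Write $[v,w]:=\Omega(v,w)$, and for a smooth curve $\gamma(t)$ in $M^2$ let $\ddot\gamma=D_t\dot\gamma$, $\gamma^{(3)}=D_t\ddot\gamma$, $\gamma^{(4)}=D_t\gamma^{(3)}$. A regular curve $\gamma$ defined on an open interval containing $0$ has a generic inflection point at $t=0$ if $[\dot\gamma(0),\ddot\gamma(0)]=0$ and $[\dot\gamma(0),\gamma^{(3)}(0)]\neq 0$. Its affine arclength measured from $t=0$ and its affine curvature (for small $t\ne 0$) are $$s_A(t)=\int_0^t\bigl|[\dot\gamma(u),\ddot\gamma(u)]\bigr|^{1/3}\,du,\qquad \kappa_A=\frac{3[\dot\gamma,\ddot\gamma][\dot\gamma,\gamma^{(4)}]+12[\dot\gamma,\ddot\gamma][\ddot\gamma,\gamma^{(3)}]-5[\dot\gamma,\gamma^{(3)}]^2}{9\,\bigl|[\dot\gamma,\ddot\gamma]\bigr|^{8/3}}.$$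 Let $C_0^\infty(\mathbf R)$ be the set of germs at $0$ of real-valued $C^\infty$ functions, let $I_0^*(\mathbf R,M^2)$ be the set of germs at $t=0$ of $C^\infty$ curves in $M^2$ with a generic inflection point at $t=0$, and let $\mathcal F_I(\gamma)$ be the germ at $0$ of the normalized affine curvature function $s_A(t)^2\kappa_A(t)$, extended to $t=0$ by its limit. Then $\mathcal F_I(\gamma)\in C_0^\infty(\mathbf R)$ for every $\gamma\in I_0^*(\mathbf R,M^2)$, and the image of $\mathcal F_I: I_0^*(\mathbf R,M^2)\to C_0^\infty(\mathbf R)$ is exactly $$\Bigl\{f\in C_0^\infty(\mathbf R):\ f(0)=-\tfrac5{16},\ \dot f(0)\neq 0\Bigr\}\ \cup\ \Bigl\{f\in C_0^\infty(\mathbf R):\ f(0)=-\tfrac5{16},\ \dot f(0)=\ddot f(0)=0\Bigr\}.$$ -/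

import Mathlib

open Set Filter Topology Bundle
open scoped Manifold ContDiff

noncomputable section

namespace EquiAffine

/-- An equi-affine structure `(D, Ω)` on a smooth surface `M`: a smooth affine connection `D`
(torsion is allowed) and a smooth nowhere vanishing 2-form `Ω` that is parallel with respect to `D`.
The surface is oriented by `Ω`. -/
structure Structure (M : Type*) [TopologicalSpace M] [ChartedSpace (EuclideanSpace ℝ (Fin 2)) M]
    [IsManifold (𝓡 2) ∞ M] where
  /-- The affine connection: `D Y x v` is `D_v Y` at the point `x`. -/
  conn : CovariantDerivative (𝓡 2) (EuclideanSpace ℝ (Fin 2)) (TangentSpace (𝓡 2) : M → Type _)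
  smooth_conn : CovariantDerivative.ContMDiffCovariantDerivative conn ∞
  /-- The 2-form `Ω`, as a field of bilinear forms. -/
  form : ∀ x : M, TangentSpace (𝓡 2) x →L[ℝ] TangentSpace (𝓡 2) x →L[ℝ] ℝ
  smooth_form : ContMDiff (𝓡 2)
    ((𝓡 2).prod 𝓘(ℝ, EuclideanSpace ℝ (Fin 2) →L[ℝ] EuclideanSpace ℝ (Fin 2) →L[ℝ] ℝ)) ∞
    (fun x ↦ TotalSpace.mk' (EuclideanSpace ℝ (Fin 2) →L[ℝ] EuclideanSpace ℝ (Fin 2) →L[ℝ] ℝ)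
      x (form x))
  form_self : ∀ (x : M) (v : TangentSpace (𝓡 2) x), form x v v = 0
  form_ne_zero : ∀ x : M, form x ≠ 0
  /-- `DΩ = 0`, that is, `v (Ω(Y, Z)) = Ω(D_v Y, Z) + Ω(Y, D_v Z)`. -/
  parallel : ∀ Y Z : (∀ x : M, TangentSpace (𝓡 2) x),
    ContMDiff (𝓡 2) (𝓡 2).tangent ∞
      (fun x ↦ (⟨x, Y x⟩ : TangentBundle (𝓡 2) M)) →
    ContMDiff (𝓡 2) (𝓡 2).tangent ∞
      (fun x ↦ (⟨x, Z x⟩ : TangentBundle (𝓡 2) M)) →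
    ∀ (x : M) (v : TangentSpace (𝓡 2) x),
      mvfderiv (𝓡 2) (fun y ↦ form y (Y y) (Z y)) x v =
        form x (conn Y x v) (Z x) + form x (Y x) (conn Z x v)

variable {M : Type*} [TopologicalSpace M] [ChartedSpace (EuclideanSpace ℝ (Fin 2)) M]

/-- The velocity `γ̇(t)` of a curve in `M`. -/
def velocity (γ : ℝ → M) (t : ℝ) : TangentSpace (𝓡 2) (γ t) :=
  mfderiv 𝓘(ℝ, ℝ) (𝓡 2) γ t (1 : ℝ)

theorem velocity_congr {γ γ' : ℝ → M} {t : ℝ} (h : γ =ᶠ[𝓝 t] γ') :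
    (velocity γ t : EuclideanSpace ℝ (Fin 2)) = velocity γ' t := by
  unfold velocity
  exact congrArg (fun L : ℝ →L[ℝ] EuclideanSpace ℝ (Fin 2) ↦ L 1) h.mfderiv_eq

variable [IsManifold (𝓡 2) ∞ M]

namespace Structure

/-- The covariant derivative `D_t V` of a vector field `V` along the curve `γ`, computed at `t` in
the coordinate frame `e₁, e₂` of the preferred chart at `γ(t)`: if `V = ∑ Vⁱ eᵢ`, then
`D_t V = ∑ (dVⁱ/dt) eᵢ + D_γ̇ (∑ Vⁱ(t) eᵢ)`, the coefficients being frozen in the last term. -/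
def covAlong (S : Structure M) (γ : ℝ → M) (V : ∀ t, TangentSpace (𝓡 2) (γ t)) (t : ℝ) :
    TangentSpace (𝓡 2) (γ t) :=
  let e := trivializationAt (EuclideanSpace ℝ (Fin 2)) (TangentSpace (𝓡 2) : M → Type _) (γ t)
  e.symm (γ t) (deriv (fun s ↦ (e ⟨γ s, V s⟩).2) t) +
    S.conn (fun p ↦ e.symm p (e ⟨γ t, V t⟩).2) (γ t) (velocity γ t)

/-- `S.jet γ k` is the vector field `γ^(k+1)` along `γ`: the velocity for `k = 0`, and then
iterated covariant derivatives `D_t` of it. -/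
def jet (S : Structure M) (γ : ℝ → M) : ℕ → ∀ t, TangentSpace (𝓡 2) (γ t)
  | 0 => velocity γ
  | k + 1 => S.covAlong γ (S.jet γ k)

/-- The bracket `[γ^(i), γ^(j)] = Ω(γ^(i), γ^(j))` of two derivatives of `γ`, for `i, j ≥ 1`. -/
def bracket (S : Structure M) (γ : ℝ → M) (i j : ℕ) (t : ℝ) : ℝ :=
  S.form (γ t) (S.jet γ (i - 1) t) (S.jet γ (j - 1) t)

/-- The affine arclength `s_A(t) = ∫₀ᵗ |[γ̇, γ̈]|^(1/3) du`, measured from `t = 0`. -/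
def arclength (S : Structure M) (γ : ℝ → M) (t : ℝ) : ℝ :=
  ∫ u in (0 : ℝ)..t, |S.bracket γ 1 2 u| ^ (1 / 3 : ℝ)

/-- The affine curvature function `κ_A` (meaningful where `[γ̇, γ̈] ≠ 0`). The power
`[γ̇, γ̈]^(8/3)` is by convention the positive number `|[γ̇, γ̈]|^(8/3)`. -/
def curvature (S : Structure M) (γ : ℝ → M) (t : ℝ) : ℝ :=
  (3 * S.bracket γ 1 2 t * S.bracket γ 1 4 t + 12 * S.bracket γ 1 2 t * S.bracket γ 2 3 t
      - 5 * S.bracket γ 1 3 t ^ 2) / (9 * |S.bracket γ 1 2 t| ^ (8 / 3 : ℝ))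

/-- The normalized affine curvature function `s_A² κ_A`. At `t = 0`, where `κ_A` is not defined,
it takes its limit. -/
def normalizedCurvature (S : Structure M) (γ : ℝ → M) : ℝ → ℝ :=
  Function.update (fun t ↦ S.arclength γ t ^ 2 * S.curvature γ t) 0
    (limUnder (𝓝[≠] (0 : ℝ)) fun t ↦ S.arclength γ t ^ 2 * S.curvature γ t)

/-- `γ` is a smooth curve on an open interval around `0`, regular at `0`, with a generic inflection
point at `t = 0`. -/
structure IsGenericInflection (S : Structure M) (γ : ℝ → M) : Prop where
  smooth : ∃ δ > 0, ContMDiffOn 𝓘(ℝ, ℝ) (𝓡 2) ∞ γ (Ioo (-δ) δ)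
  regular : velocity γ 0 ≠ 0
  inflection : S.bracket γ 1 2 0 = 0
  generic : S.bracket γ 1 3 0 ≠ 0

/-- The set of germs at `0` of smooth curves in `M` with a generic inflection point at `t = 0`. -/
def inflectionGerms (S : Structure M) : Set (Germ (𝓝 (0 : ℝ)) M) :=
  {c | ∃ γ : ℝ → M, (γ : Germ (𝓝 (0 : ℝ)) M) = c ∧ S.IsGenericInflection γ}

end Structure

namespace Structure

theorem covAlong_congr (S : Structure M) {γ γ' : ℝ → M} {V : ∀ t, TangentSpace (𝓡 2) (γ t)}
    {V' : ∀ t, TangentSpace (𝓡 2) (γ' t)} {t : ℝ} (h : γ =ᶠ[𝓝 t] γ')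
    (hV : ∀ᶠ s in 𝓝 t, (V s : EuclideanSpace ℝ (Fin 2)) = V' s) :
    (S.covAlong γ V t : EuclideanSpace ℝ (Fin 2)) = S.covAlong γ' V' t := by
  let E2 := EuclideanSpace ℝ (Fin 2)
  let F : M → (ℝ → M) → (ℝ → E2) → E2 → E2 → E2 := fun p c W v w ↦
    let e := trivializationAt E2 (TangentSpace (𝓡 2) : M → Type _) p
    (e.symm p (deriv (fun s ↦ (e (⟨c s, W s⟩ : TangentBundle (𝓡 2) M)).2) t) : E2) +
      S.conn (fun q ↦ e.symm q (e (⟨p, v⟩ : TangentBundle (𝓡 2) M)).2) p w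
  have key : ∀ p v w, F p γ V v w = F p γ' V' v w := by
    intro p v w
    have hd : deriv (fun s ↦ (trivializationAt E2 (TangentSpace (𝓡 2) : M → Type _) p
        (⟨γ s, V s⟩ : TangentBundle (𝓡 2) M)).2) t =
        deriv (fun s ↦ (trivializationAt E2 (TangentSpace (𝓡 2) : M → Type _) p
        (⟨γ' s, V' s⟩ : TangentBundle (𝓡 2) M)).2) t := by
      apply Filter.EventuallyEq.deriv_eq
      filter_upwards [h, hV] with s hs hVs
      exact congrArg₂ (fun (q : M) (x : E2) ↦
        (trivializationAt E2 (TangentSpace (𝓡 2) : M → Type _) p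
          (⟨q, x⟩ : TangentBundle (𝓡 2) M)).2) hs hVs
    simp only [F]
    rw [hd]
  have h2 : F (γ t) γ' V' (V t) (velocity γ t) = F (γ' t) γ' V' (V' t) (velocity γ' t) := by
    rw [h.eq_of_nhds]
    exact congrArg₂ (fun v w : E2 ↦ F (γ' t) γ' V' v w) hV.self_of_nhds (velocity_congr h)
  exact (key _ _ _).trans h2

theorem jet_congr (S : Structure M) {γ γ' : ℝ → M} (k : ℕ) : ∀ {t : ℝ}, γ =ᶠ[𝓝 t] γ' →
    (S.jet γ k t : EuclideanSpace ℝ (Fin 2)) = S.jet γ' k t := by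
  induction k with
  | zero => intro t h; exact velocity_congr h
  | succ k ih =>
    intro t h
    exact S.covAlong_congr h (h.eventuallyEq_nhds.mono fun s hs ↦ ih hs)

theorem bracket_congr (S : Structure M) {γ γ' : ℝ → M} {t : ℝ} (i j : ℕ) (h : γ =ᶠ[𝓝 t] γ') :
    S.bracket γ i j t = S.bracket γ' i j t := by
  let G : M → EuclideanSpace ℝ (Fin 2) → EuclideanSpace ℝ (Fin 2) → ℝ := fun p v w ↦ S.form p v w
  change G (γ t) (S.jet γ (i - 1) t) (S.jet γ (j - 1) t) =
    G (γ' t) (S.jet γ' (i - 1) t) (S.jet γ' (j - 1) t)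
  rw [h.eq_of_nhds]
  exact congrArg₂ (G (γ' t)) (S.jet_congr _ h) (S.jet_congr _ h)

theorem normalizedCurvature_congr (S : Structure M) {γ γ' : ℝ → M} (h : γ =ᶠ[𝓝 0] γ') :
    S.normalizedCurvature γ =ᶠ[𝓝 0] S.normalizedCurvature γ' := by
  obtain ⟨ε, hε, hb⟩ := Metric.eventually_nhds_iff_ball.1 h.eventuallyEq_nhds
  have hs : ∀ t ∈ Metric.ball (0 : ℝ) ε, S.arclength γ t = S.arclength γ' t := by
    intro t ht
    refine intervalIntegral.integral_congr fun u hu ↦ ?_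
    have hu' : u ∈ Metric.ball (0 : ℝ) ε :=
      (convex_ball (0 : ℝ) ε).ordConnected.uIcc_subset (Metric.mem_ball_self hε) ht hu
    simp only [S.bracket_congr 1 2 (hb u hu')]
  have hp : (fun t ↦ S.arclength γ t ^ 2 * S.curvature γ t) =ᶠ[𝓝 0]
      fun t ↦ S.arclength γ' t ^ 2 * S.curvature γ' t := by
    filter_upwards [Metric.ball_mem_nhds (0 : ℝ) hε] with t ht
    simp only [hs t ht, curvature, S.bracket_congr _ _ (hb t ht)]
  have hl : limUnder (𝓝[≠] (0 : ℝ)) (fun t ↦ S.arclength γ t ^ 2 * S.curvature γ t) =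
      limUnder (𝓝[≠] (0 : ℝ)) fun t ↦ S.arclength γ' t ^ 2 * S.curvature γ' t := by
    unfold limUnder
    rw [Filter.map_congr (hp.filter_mono nhdsWithin_le_nhds)]
  filter_upwards [hp] with t ht
  by_cases h0 : t = 0
  · subst h0
    simpa [normalizedCurvature] using hl
  · simpa [normalizedCurvature, Function.update_of_ne h0] using ht

/-- The map `γ ↦ s_A² κ_A` from germs of curves to germs of functions at `0`. -/
def normalizedCurvatureGerm (S : Structure M) : Germ (𝓝 (0 : ℝ)) M → Germ (𝓝 (0 : ℝ)) ℝ :=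
  Germ.map' S.normalizedCurvature fun _ _ h ↦ S.normalizedCurvature_congr h

end Structure

/-- `f` is smooth on an open interval around `0`, so that its germ belongs to `C₀^∞(ℝ)`. -/
def SmoothNearZero (f : ℝ → ℝ) : Prop :=
  ∃ δ > 0, ContDiffOn ℝ ∞ f (Ioo (-δ) δ)

end EquiAffine

end

/-! Since Ω is parallel, b = [γ̇, γ̈] has derivative [γ̇, γ⁽³⁾] and second derivative [γ̈, γ⁽³⁾] +
[γ̇, γ⁽⁴⁾]; torsion plays no role. At a generic inflection b has a simple zero, so b = ±σ σ'³ for a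
parameter σ with σ(0) = 0 and σ' > 0 (`exists_normal_parameter`). Then |s_A| = (3/4)|σ|^(4/3), the
fractional powers in s_A² κ_A cancel, and it becomes -5/16 + t H, where H is smooth in t and built
from σ, its derivatives and w = [γ̈, γ⁽³⁾] (`sq_arclength_mul_curvature`).

Necessity: for f = -5/16 + t H one has f'(0) = H(0) and f''(0) = 2 H'(0). Four vectors in a plane
satisfy a Plücker relation; because b(0) = 0 it reduces at 0 to [γ̇, γ⁽³⁾][γ̈, γ⁽⁴⁾] = [γ̇,
γ⁽⁴⁾][γ̈, γ⁽³⁾], which fixes w'(0). If H(0) = 0, this value forces H'(0) = 0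
(`deriv_reducedCurvature_zero`).

Sufficiency: prescribe σ' = 1 + k t and look for a curve with a unimodular frame satisfying γ̇ = r
e₁, D_t e₁ = r(a e₁ + σ e₂), D_t e₂ = r(p e₁ - a e₂), where r = σ'. Matching H determines a, while p
must solve σ p = -(a'/r + a²). This is smoothly solvable when the right side vanishes at 0, a
condition linear in k that has a solution exactly when H(0) ≠ 0 or H(0) = H'(0) = 0
(`exists_compatible_coefficient`). The curve then comes from an ODE
(`LocalStructure.exists_framed_curve`).

All of this is done in an open set of the plane; `Structure.exists_localStructure` and
`LocalStructure.Represents.bracket_eq` transfer it to the surface. -/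

noncomputable section

namespace EquiAffine

/-! ### Smooth division and the normal parameter at a simple zero. -/

theorem hasDerivAt_integral_mul_comp_mul {δ : ℝ} {g w : ℝ → ℝ}
    (hg : ContDiffOn ℝ 1 g (Ioo (-δ) δ)) (hw : Continuous w) {t : ℝ} (ht : t ∈ Ioo (-δ) δ) :
    HasDerivAt (fun t ↦ ∫ v in (0 : ℝ)..1, w v * g (t * v))
      (∫ v in (0 : ℝ)..1, (w v * v) * deriv g (t * v)) t := by
  -- On the compact interval [-ρ, ρ], stable under multiplication by v ∈ [0, 1], `deriv g` is
  -- bounded; this supplies the dominating constant.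
  obtain ⟨ρ, hρ1, hρ2⟩ := exists_between (abs_lt.2 ht)
  have hρ0 : 0 < ρ := (abs_nonneg t).trans_lt hρ1
  have hmul : ∀ s ∈ Icc (-ρ) ρ, ∀ v ∈ Icc (0 : ℝ) 1, s * v ∈ Icc (-ρ) ρ := by
    intro s hs v hv
    rw [mem_Icc, ← abs_le] at hs ⊢
    rw [abs_mul, abs_of_nonneg hv.1]
    nlinarith [abs_nonneg s, hv.1, hv.2]
  have hsub : Icc (-ρ) ρ ⊆ Ioo (-δ) δ := fun x hx ↦ ⟨by linarith [hx.1], by linarith [hx.2]⟩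
  have hgc : ContinuousOn g (Icc (-ρ) ρ) := hg.continuousOn.mono hsub
  have hgd : ContinuousOn (deriv g) (Icc (-ρ) ρ) :=
    (hg.continuousOn_deriv_of_isOpen isOpen_Ioo le_rfl).mono hsub
  have huI : uIoc (0 : ℝ) 1 ⊆ Icc 0 1 := by
    rw [uIoc_of_le zero_le_one]; exact Ioc_subset_Icc_self
  have hcont : ∀ s ∈ Icc (-ρ) ρ, ContinuousOn (fun v ↦ w v * g (s * v)) (Icc (0 : ℝ) 1) :=
    fun s hs ↦ hw.continuousOn.mul (hgc.comp (by fun_prop) (fun v hv ↦ hmul s hs v hv))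
  have hcont' : ∀ s ∈ Icc (-ρ) ρ,
      ContinuousOn (fun v ↦ w v * v * deriv g (s * v)) (Icc (0 : ℝ) 1) :=
    fun s hs ↦ (hw.mul continuous_id).continuousOn.mul
      (hgd.comp (by fun_prop) (fun v hv ↦ hmul s hs v hv))
  have htρ : t ∈ Icc (-ρ) ρ := abs_le.1 hρ1.le
  obtain ⟨C1, hC1⟩ := isCompact_Icc.exists_bound_of_continuousOn hgd
  obtain ⟨C2, hC2⟩ := (isCompact_Icc (a := (0 : ℝ)) (b := 1)).exists_bound_of_continuousOn
    (hw.mul continuous_id).continuousOn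
  have hev : Ioo (-ρ) ρ ∈ 𝓝 t := isOpen_Ioo.mem_nhds (abs_lt.1 hρ1)
  refine (intervalIntegral.hasDerivAt_integral_of_dominated_loc_of_deriv_le
    (F := fun s v ↦ w v * g (s * v)) (F' := fun s v ↦ w v * v * deriv g (s * v))
    (bound := fun _ ↦ C2 * C1) hev ?_ ?_ ?_ ?_ ?_ ?_).2
  · filter_upwards [hev] with s hs
    exact ((hcont s (Ioo_subset_Icc_self hs)).mono huI).aestronglyMeasurable measurableSet_uIoc
  · exact ContinuousOn.intervalIntegrable (by rw [uIcc_of_le zero_le_one]; exact hcont t htρ)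
  · exact ((hcont' t htρ).mono huI).aestronglyMeasurable measurableSet_uIoc
  · refine Eventually.of_forall fun v hv s hs ↦ ?_
    rw [norm_mul]
    exact mul_le_mul (hC2 v (huI hv)) (hC1 _ (hmul s (Ioo_subset_Icc_self hs) v (huI hv)))
      (norm_nonneg _) ((norm_nonneg _).trans (hC2 v (huI hv)))
  · exact intervalIntegrable_const
  · refine Eventually.of_forall fun v hv s hs ↦ ?_
    have hd : HasDerivAt g (deriv g (s * v)) (s * v) :=
      ((hg.contDiffAt (isOpen_Ioo.mem_nhds
        (hsub (hmul s (Ioo_subset_Icc_self hs) v (huI hv))))).differentiableAt (by simp)).hasDerivAt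
    have := (hd.comp s ((hasDerivAt_id s).mul_const v)).const_mul (w v)
    exact this.congr_deriv (by ring)

/-- Differentiating in t gives an integral of the same shape, with weight w(v) v and g' in place of
g, so induction on the order applies. The weight need only be continuous, which admits v^(1/3). -/
theorem contDiffOn_integral_mul_comp_mul {δ : ℝ} {g w : ℝ → ℝ}
    (hg : ContDiffOn ℝ ∞ g (Ioo (-δ) δ)) (hw : Continuous w) :
    ContDiffOn ℝ ∞ (fun t ↦ ∫ v in (0 : ℝ)..1, w v * g (t * v)) (Ioo (-δ) δ) := by
  rw [contDiffOn_infty]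
  intro n
  induction n generalizing g w with
  | zero =>
    rw [Nat.cast_zero, contDiffOn_zero]
    exact fun t ht ↦ (hasDerivAt_integral_mul_comp_mul (hg.of_le (by simp)) hw
      ht).continuousAt.continuousWithinAt
  | succ n ih =>
    rw [Nat.cast_succ, contDiffOn_succ_iff_deriv_of_isOpen isOpen_Ioo]
    have hd := fun t ht ↦ hasDerivAt_integral_mul_comp_mul (t := t) (hg.of_le (by simp)) hw ht
    refine ⟨fun t ht ↦ (hd t ht).differentiableAt.differentiableWithinAt, by simp, ?_⟩
    exact (ih (hg.deriv_of_isOpen isOpen_Ioo (by simp)) (hw.mul continuous_id)).congr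
      fun t ht ↦ (hd t ht).deriv

theorem mul_mem_Ioo_of_mem_Icc {δ t v : ℝ} (ht : t ∈ Ioo (-δ) δ) (hv : v ∈ Icc (0 : ℝ) 1) :
    t * v ∈ Ioo (-δ) δ := by
  rw [mem_Ioo, ← abs_lt] at ht ⊢
  rw [abs_mul, abs_of_nonneg hv.1]
  nlinarith [abs_nonneg t, hv.1, hv.2]

theorem ContDiffOn.hasDerivAt_of_Ioo {δ : ℝ} {F : Type*} [NormedAddCommGroup F] [NormedSpace ℝ F]
    {g : ℝ → F} {n : WithTop ℕ∞} (hn : n ≠ 0)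
    (hg : ContDiffOn ℝ n g (Ioo (-δ) δ)) {t : ℝ} (ht : t ∈ Ioo (-δ) δ) :
    HasDerivAt g (deriv g t) t :=
  ((hg.contDiffAt (isOpen_Ioo.mem_nhds ht)).differentiableAt hn).hasDerivAt

/-- Hadamard's lemma on an interval. -/
theorem exists_smooth_eq_mul {δ : ℝ} {g : ℝ → ℝ} (hg : ContDiffOn ℝ ∞ g (Ioo (-δ) δ))
    (h0 : g 0 = 0) :
    ∃ h : ℝ → ℝ, ContDiffOn ℝ ∞ h (Ioo (-δ) δ) ∧ ∀ t ∈ Ioo (-δ) δ, g t = t * h t := by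
  have hg' : ContDiffOn ℝ ∞ (deriv g) (Ioo (-δ) δ) := hg.deriv_of_isOpen isOpen_Ioo (by simp)
  refine ⟨_, contDiffOn_integral_mul_comp_mul hg' (continuous_const (y := (1 : ℝ))), ?_⟩
  intro t ht
  have hd : ∀ v ∈ uIcc (0 : ℝ) 1, HasDerivAt (fun v ↦ g (t * v)) (t * deriv g (t * v)) v := by
    intro v hv
    rw [uIcc_of_le zero_le_one] at hv
    have := (ContDiffOn.hasDerivAt_of_Ioo (by simp) hg (mul_mem_Ioo_of_mem_Icc ht hv)).comp v
      ((hasDerivAt_id v).const_mul t)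
    exact this.congr_deriv (by ring)
  have hi : IntervalIntegrable (fun v ↦ t * deriv g (t * v)) MeasureTheory.volume 0 1 := by
    apply ContinuousOn.intervalIntegrable
    rw [uIcc_of_le zero_le_one]
    exact continuousOn_const.mul (hg'.continuousOn.comp (by fun_prop)
      fun v hv ↦ mul_mem_Ioo_of_mem_Icc ht hv)
  have := intervalIntegral.integral_eq_sub_of_hasDerivAt hd hi
  rw [intervalIntegral.integral_const_mul] at this
  simpa [h0] using this.symm

/-- A smooth solution `h` of the singular equation `(4/3) h + t h' = G`. -/
theorem exists_smooth_singular_solution {δ : ℝ} {G : ℝ → ℝ}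
    (hG : ContDiffOn ℝ ∞ G (Ioo (-δ) δ)) (hpos : ∀ t ∈ Ioo (-δ) δ, 0 < G t) :
    ∃ h : ℝ → ℝ, ContDiffOn ℝ ∞ h (Ioo (-δ) δ) ∧ (∀ t ∈ Ioo (-δ) δ, 0 < h t) ∧
      ∀ t ∈ Ioo (-δ) δ, 4 / 3 * h t + t * deriv h t = G t := by
  have hw : Continuous fun v : ℝ ↦ v ^ (1 / 3 : ℝ) :=
    Real.continuous_rpow_const (by norm_num)
  have hG' : ContDiffOn ℝ ∞ (deriv G) (Ioo (-δ) δ) := hG.deriv_of_isOpen isOpen_Ioo (by simp)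
  -- The solution regular at 0 is h(t) = ∫₀¹ v^(1/3) G(tv) dv; the equation is the integral over [0,
  -- 1] of the v-derivative of v^(4/3) G(tv).
  refine ⟨_, contDiffOn_integral_mul_comp_mul hG hw, ?_, ?_⟩
  · intro t ht
    refine intervalIntegral.intervalIntegral_pos_of_pos_on ?_ ?_ one_pos
    · apply ContinuousOn.intervalIntegrable
      rw [uIcc_of_le zero_le_one]
      exact hw.continuousOn.mul (hG.continuousOn.comp (by fun_prop)
        fun v hv ↦ mul_mem_Ioo_of_mem_Icc ht hv)
    · exact fun v hv ↦ mul_pos (Real.rpow_pos_of_pos hv.1 _)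
        (hpos _ (mul_mem_Ioo_of_mem_Icc ht (Ioo_subset_Icc_self hv)))
  · intro t ht
    rw [(hasDerivAt_integral_mul_comp_mul (hG.of_le (by simp)) hw ht).deriv]
    have hc1 : ContinuousOn (fun v ↦ v ^ (1 / 3 : ℝ) * G (t * v)) (Icc (0 : ℝ) 1) :=
      hw.continuousOn.mul (hG.continuousOn.comp (by fun_prop)
        fun v hv ↦ mul_mem_Ioo_of_mem_Icc ht hv)
    have hc2 : ContinuousOn (fun v ↦ v ^ (1 / 3 : ℝ) * v * deriv G (t * v)) (Icc (0 : ℝ) 1) :=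
      (hw.mul continuous_id).continuousOn.mul (hG'.continuousOn.comp (by fun_prop)
        fun v hv ↦ mul_mem_Ioo_of_mem_Icc ht hv)
    rw [← uIcc_of_le zero_le_one] at hc1 hc2
    have hd : ∀ v ∈ uIcc (0 : ℝ) 1, HasDerivAt (fun v ↦ v ^ (4 / 3 : ℝ) * G (t * v))
        (4 / 3 * (v ^ (1 / 3 : ℝ) * G (t * v)) + t * (v ^ (1 / 3 : ℝ) * v * deriv G (t * v))) v := by
      intro v hv
      rw [uIcc_of_le zero_le_one] at hv
      have h1 := (ContDiffOn.hasDerivAt_of_Ioo (by simp) hG (mul_mem_Ioo_of_mem_Icc ht hv)).comp v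
        ((hasDerivAt_id v).const_mul t)
      have h2 := Real.hasDerivAt_rpow_const (x := v) (p := 4 / 3) (Or.inr (by norm_num))
      refine (h2.mul h1).congr_deriv ?_
      have e : v ^ (4 / 3 : ℝ) = v ^ (1 / 3 : ℝ) * v := by
        rw [← Real.rpow_add_one' hv.1 (by norm_num)]; norm_num
      simp only [e, Function.comp, show (4 / 3 - 1 : ℝ) = 1 / 3 by norm_num]
      ring
    have hi1 := hc1.intervalIntegrable.const_mul (μ := MeasureTheory.volume) (4 / 3 : ℝ)
    have hi2 := hc2.intervalIntegrable.const_mul (μ := MeasureTheory.volume) t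
    have := intervalIntegral.integral_eq_sub_of_hasDerivAt hd (hi1.add hi2)
    rw [intervalIntegral.integral_add hi1 hi2, intervalIntegral.integral_const_mul,
      intervalIntegral.integral_const_mul] at this
    rw [this]
    simp

/-- A smooth function with a simple zero at `0` equals `± σ σ'³` for a local change of parameter
`σ`. -/
theorem exists_normal_parameter {δ : ℝ} {m : ℝ → ℝ} (hm : ContDiffOn ℝ ∞ m (Ioo (-δ) δ))
    (hpos : ∀ t ∈ Ioo (-δ) δ, 0 < m t) :
    ∃ q : ℝ → ℝ, ContDiffOn ℝ ∞ q (Ioo (-δ) δ) ∧ (∀ t ∈ Ioo (-δ) δ, 0 < q t) ∧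
      (∀ t ∈ Ioo (-δ) δ, 0 < q t + t * deriv q t) ∧
      ∀ t ∈ Ioo (-δ) δ, t * m t = (t * q t) * (q t + t * deriv q t) ^ 3 := by
  -- For t > 0 the equation σ σ'³ = t m reads (σ^(4/3))' = (4/3)(t m)^(1/3). Setting σ^(4/3) = (4/3)
  -- t^(4/3) h turns it into (4/3) h + t h' = m^(1/3), and then q = σ/t = ((4/3) h)^(3/4).
  have hG : ContDiffOn ℝ ∞ (fun t ↦ m t ^ (1 / 3 : ℝ)) (Ioo (-δ) δ) :=
    hm.rpow_const_of_ne fun t ht ↦ (hpos t ht).ne'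
  obtain ⟨h, hh, hh0, hh1⟩ :=
    exists_smooth_singular_solution hG fun t ht ↦ Real.rpow_pos_of_pos (hpos t ht) _
  have hh2 : ContDiffOn ℝ ∞ (fun t ↦ 4 / 3 * h t) (Ioo (-δ) δ) := contDiffOn_const.mul hh
  have hp : ∀ t ∈ Ioo (-δ) δ, 0 < 4 / 3 * h t := fun t ht ↦ by have := hh0 t ht; positivity
  have key : ∀ t ∈ Ioo (-δ) δ, (4 / 3 * h t) ^ (3 / 4 : ℝ) +
      t * deriv (fun t ↦ (4 / 3 * h t) ^ (3 / 4 : ℝ)) t =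
      (4 / 3 * h t) ^ (-(1 / 4) : ℝ) * m t ^ (1 / 3 : ℝ) := by
    intro t ht
    have hd : HasDerivAt (fun t ↦ 4 / 3 * h t) (4 / 3 * deriv h t) t :=
      (ContDiffOn.hasDerivAt_of_Ioo (by simp) hh ht).const_mul _
    rw [(hd.rpow_const (p := 3 / 4) (Or.inl (hp t ht).ne')).deriv, ← hh1 t ht]
    have e : (4 / 3 * h t) ^ (3 / 4 : ℝ) = (4 / 3 * h t) ^ (-(1 / 4) : ℝ) * (4 / 3 * h t) := by
      rw [← Real.rpow_add_one (hp t ht).ne']; norm_num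
    rw [e, show (3 / 4 - 1 : ℝ) = -(1 / 4) by norm_num]
    ring
  refine ⟨fun t ↦ (4 / 3 * h t) ^ (3 / 4 : ℝ), hh2.rpow_const_of_ne fun t ht ↦ (hp t ht).ne',
    fun t ht ↦ Real.rpow_pos_of_pos (hp t ht) _, fun t ht ↦ ?_, fun t ht ↦ ?_⟩
  · rw [key t ht]
    exact mul_pos (Real.rpow_pos_of_pos (hp t ht) _) (Real.rpow_pos_of_pos (hpos t ht) _)
  · rw [key t ht, mul_pow, ← Real.rpow_natCast (m t ^ (1 / 3 : ℝ)), ← Real.rpow_mul (hpos t ht).le,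
      ← Real.rpow_natCast ((4 / 3 * h t) ^ (-(1 / 4) : ℝ)), ← Real.rpow_mul (hp t ht).le]
    have : (4 / 3 * h t) ^ (3 / 4 : ℝ) * (4 / 3 * h t) ^ (-(1 / 4) * ((3 : ℕ) : ℝ)) = 1 := by
      rw [← Real.rpow_add (hp t ht)]; norm_num
    calc t * m t = t * ((4 / 3 * h t) ^ (3 / 4 : ℝ) * (4 / 3 * h t) ^ (-(1 / 4) * ((3 : ℕ) : ℝ)))
          * m t := by rw [this, mul_one]
      _ = _ := by norm_num; ring

/-! ### The normalized curvature in the normal parameter. -/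

theorem abs_sign_mul {ε a : ℝ} (hε : ε = 1 ∨ ε = -1) : |ε * a| = |a| := by
  rcases hε with rfl | rfl <;> simp

theorem abs_mul_cube_rpow {ε σ r p : ℝ} (hε : ε = 1 ∨ ε = -1) (hr : 0 < r) :
    |ε * (σ * r ^ 3)| ^ p = |σ| ^ p * r ^ (3 * p) := by
  rw [abs_sign_mul hε, abs_mul, abs_of_pos (pow_pos hr 3),
    Real.mul_rpow (abs_nonneg _) (pow_pos hr 3).le, ← Real.rpow_natCast r 3, ← Real.rpow_mul hr.le]
  norm_num

/-- The integrand is |σ|^(1/3) σ', with primitive ±(3/4)|σ|^(4/3). Squaring removes the sign, which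
depends on the side of 0. -/
theorem sq_integral_abs_rpow {δ ε : ℝ} {q r σ b : ℝ → ℝ} (hε : ε = 1 ∨ ε = -1)
    (hσ : ∀ t ∈ Ioo (-δ) δ, HasDerivAt σ (r t) t)
    (hσq : ∀ t ∈ Ioo (-δ) δ, σ t = t * q t) (hq : ∀ t ∈ Ioo (-δ) δ, 0 < q t)
    (hr : ∀ t ∈ Ioo (-δ) δ, 0 < r t) (hrc : ContinuousOn r (Ioo (-δ) δ))
    (hb : ∀ t ∈ Ioo (-δ) δ, b t = ε * (σ t * r t ^ 3)) {t : ℝ} (ht : t ∈ Ioo (-δ) δ) :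
    (∫ u in (0 : ℝ)..t, |b u| ^ (1 / 3 : ℝ)) ^ 2 = 9 / 16 * |σ t| ^ (8 / 3 : ℝ) := by
  have h0 : (0 : ℝ) ∈ Ioo (-δ) δ := by
    have := ht.1.trans ht.2
    constructor <;> linarith
  have hsub : uIcc 0 t ⊆ Ioo (-δ) δ := ordConnected_Ioo.uIcc_subset h0 ht
  have hσ0 : σ 0 = 0 := by rw [hσq 0 h0, zero_mul]
  have hσc : ContinuousOn σ (Ioo (-δ) δ) := fun u hu ↦ (hσ u hu).continuousAt.continuousWithinAt
  -- τ is the constant sign of σ between 0 and t. The exponent 4/3 exceeds 1, so the primitive is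
  -- differentiable even at the zero of σ.
  have hint : ∀ τ : ℝ, (τ = 1 ∨ τ = -1) → (∀ u ∈ uIcc 0 t, |σ u| = τ * σ u) →
      ∫ u in (0 : ℝ)..t, |b u| ^ (1 / 3 : ℝ) = τ * (3 / 4 * |σ t| ^ (4 / 3 : ℝ)) := by
    intro τ hτ hs
    have hττ : τ * τ = 1 := by rcases hτ with rfl | rfl <;> norm_num
    have e1 : EqOn (fun u ↦ |b u| ^ (1 / 3 : ℝ)) (fun u ↦ (τ * σ u) ^ (1 / 3 : ℝ) * r u)
        (uIcc 0 t) := by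
      intro u hu
      simp only
      rw [hb u (hsub hu), abs_mul_cube_rpow hε (hr u (hsub hu)), hs u hu]
      norm_num
    rw [intervalIntegral.integral_congr e1]
    have hd : ∀ u ∈ uIcc 0 t, HasDerivAt (fun u ↦ τ * (3 / 4 * (τ * σ u) ^ (4 / 3 : ℝ)))
        ((τ * σ u) ^ (1 / 3 : ℝ) * r u) u := by
      intro u hu
      have := ((((hσ u (hsub hu)).const_mul τ).rpow_const (p := 4 / 3)
        (Or.inr (by norm_num))).const_mul (3 / 4)).const_mul τ
      refine this.congr_deriv ?_
      rw [show (4 / 3 - 1 : ℝ) = 1 / 3 by norm_num]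
      linear_combination (r u * (τ * σ u) ^ (1 / 3 : ℝ)) * hττ
    have hi : IntervalIntegrable (fun u ↦ (τ * σ u) ^ (1 / 3 : ℝ) * r u)
        MeasureTheory.volume 0 t := by
      apply ContinuousOn.intervalIntegrable
      refine ContinuousOn.mul ?_ (hrc.mono hsub)
      exact (continuousOn_const.mul (hσc.mono hsub)).rpow_const fun _ _ ↦ Or.inr (by norm_num)
    rw [intervalIntegral.integral_eq_sub_of_hasDerivAt hd hi, hσ0, ← hs t right_mem_uIcc]
    simp
  have hfin : ∀ τ : ℝ, (τ = 1 ∨ τ = -1) → (τ * (3 / 4 * |σ t| ^ (4 / 3 : ℝ))) ^ 2 =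
      9 / 16 * |σ t| ^ (8 / 3 : ℝ) := by
    intro τ hτ
    have : (|σ t| ^ (4 / 3 : ℝ)) ^ 2 = |σ t| ^ (8 / 3 : ℝ) := by
      rw [← Real.rpow_natCast, ← Real.rpow_mul (abs_nonneg _)]; norm_num
    rw [← this]
    rcases hτ with rfl | rfl <;> ring
  rcases le_total 0 t with h | h
  · rw [hint 1 (Or.inl rfl), hfin 1 (Or.inl rfl)]
    intro u hu
    rw [one_mul, abs_of_nonneg]
    rw [hσq u (hsub hu)]
    rw [uIcc_of_le h] at hu
    exact mul_nonneg hu.1 (hq u (hsub (uIcc_of_le h ▸ hu))).le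
  · rw [hint (-1) (Or.inr rfl), hfin (-1) (Or.inr rfl)]
    intro u hu
    rw [neg_one_mul, abs_of_nonpos]
    rw [hσq u (hsub hu)]
    rw [uIcc_of_ge h] at hu
    exact mul_nonpos_of_nonpos_of_nonneg hu.2 (hq u (hsub (uIcc_of_ge h ▸ hu))).le

/-- The germ `H` with `s_A² κ_A = -5/16 + t H`, in terms of the normal parameter `σ = t q`,
`r = σ'`, and of `w = [γ̈, γ⁽³⁾]`. -/
def reducedCurvature (ε : ℝ) (q r r₁ r₂ w : ℝ → ℝ) (t : ℝ) : ℝ :=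
  9 / 16 * (q t * ((ε * w t - r t ^ 3 * r₁ t) / r t ^ 5) +
    t * q t ^ 2 * ((r t * r₂ t - 3 * r₁ t ^ 2) / r t ^ 4))

theorem bracket_deriv_eq {δ ε : ℝ} {r r₁ σ b12 b13 : ℝ → ℝ}
    (hσ : ∀ t ∈ Ioo (-δ) δ, HasDerivAt σ (r t) t)
    (hr1 : ∀ t ∈ Ioo (-δ) δ, HasDerivAt r (r₁ t) t)
    (hb : ∀ t ∈ Ioo (-δ) δ, b12 t = ε * (σ t * r t ^ 3))
    (h13 : ∀ t ∈ Ioo (-δ) δ, HasDerivAt b12 (b13 t) t)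
    {t : ℝ} (ht : t ∈ Ioo (-δ) δ) :
    b13 t = ε * (r t ^ 4 + 3 * σ t * r t ^ 2 * r₁ t) := by
  have h := ((hσ t ht).mul ((hr1 t ht).pow 3)).const_mul ε
  have e : b12 =ᶠ[𝓝 t] fun t ↦ ε * (σ t * r t ^ 3) :=
    Filter.eventually_of_mem (isOpen_Ioo.mem_nhds ht) hb
  rw [((h13 t ht).congr_of_eventuallyEq e.symm).unique h]
  simp only [Pi.pow_apply]
  push_cast
  ring

theorem bracket_deriv_deriv_eq {δ ε : ℝ} {r r₁ r₂ σ b12 b13 b14 b23 : ℝ → ℝ}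
    (hσ : ∀ t ∈ Ioo (-δ) δ, HasDerivAt σ (r t) t)
    (hr1 : ∀ t ∈ Ioo (-δ) δ, HasDerivAt r (r₁ t) t)
    (hr2 : ∀ t ∈ Ioo (-δ) δ, HasDerivAt r₁ (r₂ t) t)
    (hb : ∀ t ∈ Ioo (-δ) δ, b12 t = ε * (σ t * r t ^ 3))
    (h13 : ∀ t ∈ Ioo (-δ) δ, HasDerivAt b12 (b13 t) t)
    (h14 : ∀ t ∈ Ioo (-δ) δ, HasDerivAt b13 (b23 t + b14 t) t)
    {t : ℝ} (ht : t ∈ Ioo (-δ) δ) :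
    b23 t + b14 t = ε * (7 * r t ^ 3 * r₁ t +
      σ t * (6 * r t * r₁ t ^ 2 + 3 * r t ^ 2 * r₂ t)) := by
  have h := (((hr1 t ht).pow 4).add ((((hσ t ht).const_mul 3).mul ((hr1 t ht).pow 2)).mul
    (hr2 t ht))).const_mul ε
  have e : b13 =ᶠ[𝓝 t] fun t ↦ ε * (r t ^ 4 + 3 * σ t * r t ^ 2 * r₁ t) :=
    Filter.eventually_of_mem (isOpen_Ioo.mem_nhds ht)
      fun _ h ↦ bracket_deriv_eq hσ hr1 hb h13 h
  rw [((h14 t ht).congr_of_eventuallyEq e.symm).unique h]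
  simp only [Pi.pow_apply, Pi.mul_apply]
  push_cast
  ring

/-- The factor |σ|^(8/3) appears both in s_A² and in the denominator of κ_A. After cancellation the
value is N/(16 r⁸), with N the numerator of κ_A; eliminating b14 through b12'' = b23 + b14 leaves
only σ, its derivatives and b23. -/
theorem sq_arclength_mul_curvature {δ ε : ℝ} {q r r₁ r₂ σ b12 b13 b14 b23 : ℝ → ℝ}
    (hσ : ∀ t ∈ Ioo (-δ) δ, HasDerivAt σ (r t) t)
    (hr1 : ∀ t ∈ Ioo (-δ) δ, HasDerivAt r (r₁ t) t)
    (hr2 : ∀ t ∈ Ioo (-δ) δ, HasDerivAt r₁ (r₂ t) t)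
    (hb : ∀ t ∈ Ioo (-δ) δ, b12 t = ε * (σ t * r t ^ 3))
    (h13 : ∀ t ∈ Ioo (-δ) δ, HasDerivAt b12 (b13 t) t)
    (h14 : ∀ t ∈ Ioo (-δ) δ, HasDerivAt b13 (b23 t + b14 t) t)
    (hε : ε = 1 ∨ ε = -1)
    (hσq : ∀ t ∈ Ioo (-δ) δ, σ t = t * q t) (hq : ∀ t ∈ Ioo (-δ) δ, 0 < q t)
    (hr : ∀ t ∈ Ioo (-δ) δ, 0 < r t) {t : ℝ} (ht : t ∈ Ioo (-δ) δ) (ht0 : t ≠ 0) :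
    (∫ u in (0 : ℝ)..t, |b12 u| ^ (1 / 3 : ℝ)) ^ 2 *
      ((3 * b12 t * b14 t + 12 * b12 t * b23 t - 5 * b13 t ^ 2) /
        (9 * |b12 t| ^ (8 / 3 : ℝ))) = -5 / 16 + t * reducedCurvature ε q r r₁ r₂ b23 t := by
  rw [sq_integral_abs_rpow hε hσ hσq hq hr
    (fun u hu ↦ (hr1 u hu).continuousAt.continuousWithinAt) hb ht, hb t ht,
    abs_mul_cube_rpow hε (hr t ht), bracket_deriv_eq hσ hr1 hb h13 ht,
    eq_sub_of_add_eq' (bracket_deriv_deriv_eq hσ hr1 hr2 hb h13 h14 ht)]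
  have hr0 := hr t ht
  have hσ0 : σ t ≠ 0 := by rw [hσq t ht]; exact mul_ne_zero ht0 (hq t ht).ne'
  have hpos : 0 < |σ t| ^ (8 / 3 : ℝ) := Real.rpow_pos_of_pos (abs_pos.2 hσ0) _
  have e8 : r t ^ (3 * (8 / 3) : ℝ) = r t ^ 8 := by
    rw [← Real.rpow_natCast]; norm_num
  rw [e8]
  have hεε : ε ^ 2 = 1 := by rcases hε with rfl | rfl <;> norm_num
  have e : ∀ X N R : ℝ, X ≠ 0 → 9 / 16 * X * (N / (9 * (X * R))) = N / (16 * R) := by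
    intro X N R hX
    field_simp
  rw [e _ _ _ hpos.ne', reducedCurvature]
  have hq' : q t = σ t / t := by rw [hσq t ht]; field_simp
  rw [hq']
  field_simp
  linear_combination (9 * r t * σ t ^ 2 * (r t * r₂ t - 3 * r₁ t ^ 2) - 5 * r t ^ 5
    - 9 * σ t * r t ^ 3 * r₁ t) * hεε

/-- The hypothesis `hg0` kills the term with q', and the explicit factor t kills the derivative of
the last quotient. -/
theorem hasDerivAt_reducedCurvature_zero {ε q' g' : ℝ} {q r r₁ r₂ w : ℝ → ℝ}
    (hq : HasDerivAt q q' 0) (hg : HasDerivAt (fun t ↦ (ε * w t - r t ^ 3 * r₁ t) / r t ^ 5) g' 0)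
    (hg0 : ε * w 0 - r 0 ^ 3 * r₁ 0 = 0) (hr : HasDerivAt r (r₁ 0) 0)
    (hr1 : HasDerivAt r₁ (r₂ 0) 0) (hr2 : DifferentiableAt ℝ r₂ 0) (hr0 : r 0 ≠ 0) :
    HasDerivAt (reducedCurvature ε q r r₁ r₂ w)
      (9 / 16 * (q 0 * g' + q 0 ^ 2 * ((r 0 * r₂ 0 - 3 * r₁ 0 ^ 2) / r 0 ^ 4))) 0 := by
  have hk : DifferentiableAt ℝ (fun t ↦ (r t * r₂ t - 3 * r₁ t ^ 2) / r t ^ 4) 0 := by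
    have := hr.differentiableAt
    have := hr1.differentiableAt
    fun_prop (disch := positivity)
  have h := ((hq.mul hg).add (((hasDerivAt_id (0 : ℝ)).mul (hq.pow 2)).mul
    hk.hasDerivAt)).const_mul (9 / 16)
  refine h.congr_deriv ?_
  simp [hg0]

/-- H(0) = 0 means w = ε r³ r₁ at 0. The Plücker relation `hpl`, in which ε r⁴ = b13 and ε(7 r³ r₁)
- w = b14 at 0, then gives ε w' = 6 r² r₁², and the two contributions to H'(0) are opposite. -/
theorem deriv_reducedCurvature_zero {ε b24 : ℝ} {q r r₁ r₂ w : ℝ → ℝ} (hε : ε ^ 2 = 1)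
    (hq : DifferentiableAt ℝ q 0) (hr : HasDerivAt r (r₁ 0) 0)
    (hr1 : HasDerivAt r₁ (r₂ 0) 0) (hr2 : DifferentiableAt ℝ r₂ 0) (hr0 : 0 < r 0)
    (hqr : q 0 = r 0) (hw' : HasDerivAt w b24 0)
    (hpl : ε * r 0 ^ 4 * b24 = (ε * (7 * r 0 ^ 3 * r₁ 0) - w 0) * w 0)
    (h0 : reducedCurvature ε q r r₁ r₂ w 0 = 0) :
    deriv (reducedCurvature ε q r r₁ r₂ w) 0 = 0 := by
  have hg0 : ε * w 0 - r 0 ^ 3 * r₁ 0 = 0 := by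
    simp only [reducedCurvature, zero_mul, add_zero, hqr] at h0
    have h5 : r 0 ^ 5 ≠ 0 := by positivity
    rcases mul_eq_zero.1 h0 with h | h
    · norm_num at h
    · rcases mul_eq_zero.1 h with h | h
      · exact absurd h hr0.ne'
      · rcases div_eq_zero_iff.1 h with h | h
        · exact h
        · exact absurd h h5
  have hn := (hw'.const_mul ε).sub ((hr.pow 3).mul hr1)
  have hg := hn.div (hr.pow 5) (by simpa using (pow_pos hr0 5).ne')
  rw [(hasDerivAt_reducedCurvature_zero hq.hasDerivAt hg hg0 hr hr1 hr2 hr0.ne').deriv]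
  have hw'0 : w 0 = ε * (r 0 ^ 3 * r₁ 0) := by linear_combination ε * hg0 - w 0 * hε
  have hb : ε * b24 = 6 * r 0 ^ 2 * r₁ 0 ^ 2 := by
    have h4 : r 0 ^ 4 ≠ 0 := by positivity
    apply mul_left_cancel₀ h4
    rw [hw'0] at hpl
    linear_combination hpl + 6 * r 0 ^ 6 * r₁ 0 ^ 2 * hε
  simp only [Pi.sub_apply, Pi.mul_apply, Pi.pow_apply, hqr]
  rw [hg0]
  field_simp
  push_cast
  linear_combination 9 * r 0 ^ 5 * hb

/-- The affine curvature function normalized by the square of the affine arclength, in terms of the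
brackets `b12 = [γ̇, γ̈]`, `b13 = [γ̇, γ⁽³⁾]`, `b14 = [γ̇, γ⁽⁴⁾]`, `b23 = [γ̈, γ⁽³⁾]`. -/
def normalizedQuotient (b12 b13 b14 b23 : ℝ → ℝ) (t : ℝ) : ℝ :=
  (∫ u in (0 : ℝ)..t, |b12 u| ^ (1 / 3 : ℝ)) ^ 2 *
    ((3 * b12 t * b14 t + 12 * b12 t * b23 t - 5 * b13 t ^ 2) / (9 * |b12 t| ^ (8 / 3 : ℝ)))

theorem Ioo_symm_subset {δ δ' : ℝ} (h : δ' ≤ δ) : Ioo (-δ') δ' ⊆ Ioo (-δ) δ :=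
  Ioo_subset_Ioo (neg_le_neg h) h

theorem exists_Ioo_symm_subset {s : Set ℝ} (hs : s ∈ 𝓝 (0 : ℝ)) {δ : ℝ} (hδ : 0 < δ) :
    ∃ δ' > 0, δ' ≤ δ ∧ Ioo (-δ') δ' ⊆ s := by
  obtain ⟨ε, hε, h⟩ := Metric.mem_nhds_iff.1 hs
  refine ⟨min ε δ, lt_min hε hδ, min_le_right _ _, fun t ht ↦ h ?_⟩
  rw [Metric.mem_ball, Real.dist_eq, sub_zero, abs_lt]
  exact Ioo_symm_subset (min_le_left _ _) ht

theorem contDiffOn_reducedCurvature {δ ε : ℝ} {q r r₁ r₂ w : ℝ → ℝ}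
    (hq : ContDiffOn ℝ ∞ q (Ioo (-δ) δ)) (hr : ContDiffOn ℝ ∞ r (Ioo (-δ) δ))
    (hr1 : ContDiffOn ℝ ∞ r₁ (Ioo (-δ) δ)) (hr2 : ContDiffOn ℝ ∞ r₂ (Ioo (-δ) δ))
    (hw : ContDiffOn ℝ ∞ w (Ioo (-δ) δ)) (hpos : ∀ t ∈ Ioo (-δ) δ, 0 < r t) :
    ContDiffOn ℝ ∞ (reducedCurvature ε q r r₁ r₂ w) (Ioo (-δ) δ) := by
  unfold reducedCurvature
  refine contDiffOn_const.mul ((hq.mul (((contDiffOn_const.mul hw).sub ((hr.pow 3).mul hr1)).div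
    (hr.pow 5) fun t ht ↦ (pow_pos (hpos t ht) 5).ne')).add
    ((contDiffOn_id.mul (hq.pow 2)).mul (((hr.mul hr2).sub (contDiffOn_const.mul (hr1.pow 2))).div
    (hr.pow 4) fun t ht ↦ (pow_pos (hpos t ht) 4).ne')))

/-- Near a generic inflection point, the normalized affine curvature function is
`-5/16 + t H` with `H` smooth, and `H(0) = 0` forces `H'(0) = 0`. -/
theorem exists_smooth_normalizedQuotient {δ : ℝ} (hδ : 0 < δ) {b12 b13 b14 b23 b24 : ℝ → ℝ}
    (s12 : ContDiffOn ℝ ∞ b12 (Ioo (-δ) δ)) (s23 : ContDiffOn ℝ ∞ b23 (Ioo (-δ) δ))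
    (h13 : ∀ t ∈ Ioo (-δ) δ, HasDerivAt b12 (b13 t) t)
    (h14 : ∀ t ∈ Ioo (-δ) δ, HasDerivAt b13 (b23 t + b14 t) t)
    (h24 : HasDerivAt b23 (b24 0) 0) (hpl : b13 0 * b24 0 = b14 0 * b23 0)
    (hb0 : b12 0 = 0) (hb1 : b13 0 ≠ 0) :
    ∃ δ' > 0, ∃ H : ℝ → ℝ, ContDiffOn ℝ ∞ H (Ioo (-δ') δ') ∧
      (∀ t ∈ Ioo (-δ') δ', t ≠ 0 →
        normalizedQuotient b12 b13 b14 b23 t = -5 / 16 + t * H t) ∧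
      (H 0 = 0 → deriv H 0 = 0) := by
  obtain ⟨m, hm, hbm⟩ := exists_smooth_eq_mul s12 hb0
  have h0 : (0 : ℝ) ∈ Ioo (-δ) δ := by simpa using hδ
  have hm0 : m 0 = b13 0 := by
    have e : b12 =ᶠ[𝓝 0] fun t ↦ t * m t :=
      Filter.eventually_of_mem (isOpen_Ioo.mem_nhds h0) hbm
    have h := (hasDerivAt_id (0 : ℝ)).mul (ContDiffOn.hasDerivAt_of_Ioo (by simp) hm h0)
    have := ((h13 0 h0).congr_of_eventuallyEq e.symm).unique h
    simpa using this.symm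
  -- The normal parameter requires a positive factor m, so the sign of b13(0) is split off as ε.
  obtain ⟨ε, hε, hε0⟩ : ∃ ε : ℝ, (ε = 1 ∨ ε = -1) ∧ 0 < ε * m 0 := by
    rcases hb1.lt_or_gt with h | h
    · exact ⟨-1, Or.inr rfl, by rw [hm0]; linarith⟩
    · exact ⟨1, Or.inl rfl, by rw [hm0]; linarith⟩
  have hεε : ε ^ 2 = 1 := by rcases hε with rfl | rfl <;> norm_num
  have hmc : ContinuousAt (fun t ↦ ε * m t) 0 :=
    continuousAt_const.mul (hm.continuousOn.continuousAt (isOpen_Ioo.mem_nhds h0))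
  obtain ⟨δ', hδ', hle, hsub⟩ := exists_Ioo_symm_subset (hmc.eventually (lt_mem_nhds hε0)) hδ
  have hI : Ioo (-δ') δ' ⊆ Ioo (-δ) δ := Ioo_symm_subset hle
  have h0' : (0 : ℝ) ∈ Ioo (-δ') δ' := by simpa using hδ'
  obtain ⟨q, hq, hq0, hr0, hqm⟩ := exists_normal_parameter (m := fun t ↦ ε * m t)
    (contDiffOn_const.mul (hm.mono hI)) hsub
  have hq1 : ContDiffOn ℝ ∞ (deriv q) (Ioo (-δ') δ') := hq.deriv_of_isOpen isOpen_Ioo (by simp)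
  set r : ℝ → ℝ := fun t ↦ q t + t * deriv q t with hr
  have sr : ContDiffOn ℝ ∞ r (Ioo (-δ') δ') := hq.add (contDiffOn_id.mul hq1)
  have sr1 : ContDiffOn ℝ ∞ (deriv r) (Ioo (-δ') δ') := sr.deriv_of_isOpen isOpen_Ioo (by simp)
  have sr2 : ContDiffOn ℝ ∞ (deriv (deriv r)) (Ioo (-δ') δ') :=
    sr1.deriv_of_isOpen isOpen_Ioo (by simp)
  have hσ : ∀ t ∈ Ioo (-δ') δ', HasDerivAt (fun t ↦ t * q t) (r t) t := by
    intro t ht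
    have h := (hasDerivAt_id t).mul (ContDiffOn.hasDerivAt_of_Ioo (by simp) hq ht)
    exact h.congr_deriv (by simp [hr])
  have hr1 : ∀ t ∈ Ioo (-δ') δ', HasDerivAt r (deriv r t) t :=
    fun t ht ↦ ContDiffOn.hasDerivAt_of_Ioo (by simp) sr ht
  have hr2 : ∀ t ∈ Ioo (-δ') δ', HasDerivAt (deriv r) (deriv (deriv r) t) t :=
    fun t ht ↦ ContDiffOn.hasDerivAt_of_Ioo (by simp) sr1 ht
  have hb : ∀ t ∈ Ioo (-δ') δ', b12 t = ε * (t * q t * r t ^ 3) := by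
    intro t ht
    rw [← hqm t ht, hbm t (hI ht)]
    linear_combination -(t * m t) * hεε
  have h13' := fun t ht ↦ h13 t (hI ht)
  have h14' := fun t ht ↦ h14 t (hI ht)
  refine ⟨δ', hδ', reducedCurvature ε q r (deriv r) (deriv (deriv r)) b23,
    contDiffOn_reducedCurvature hq sr sr1 sr2 (s23.mono hI) hr0, fun t ht ht0 ↦
    sq_arclength_mul_curvature hσ hr1 hr2 hb h13' h14' hε (fun _ _ ↦ rfl) hq0 hr0 ht ht0, ?_⟩
  have e1 := bracket_deriv_eq hσ hr1 hb h13' h0'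
  have e2 := bracket_deriv_deriv_eq hσ hr1 hr2 hb h13' h14' h0'
  refine deriv_reducedCurvature_zero hεε
    (ContDiffOn.hasDerivAt_of_Ioo (by simp) hq h0').differentiableAt (hr1 0 h0') (hr2 0 h0')
    (ContDiffOn.hasDerivAt_of_Ioo (by simp) sr2 h0').differentiableAt (hr0 0 h0')
    (by simp [hr]) h24 ?_
  simp only [zero_mul, mul_zero, add_zero] at e1 e2
  rw [← e1, hpl]
  linear_combination b23 0 * e2

/-- Translates the conditions on H(0) and H'(0) into conditions on the first two derivatives of the
normalized curvature. -/
theorem deriv_zero_of_eq_add_mul {δ c : ℝ} (hδ : 0 < δ) {F H : ℝ → ℝ}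
    (hH : ContDiffOn ℝ ∞ H (Ioo (-δ) δ)) (hF : ∀ t ∈ Ioo (-δ) δ, F t = c + t * H t) :
    deriv F 0 = H 0 ∧ iteratedDeriv 2 F 0 = 2 * deriv H 0 := by
  have h0 : (0 : ℝ) ∈ Ioo (-δ) δ := by simpa using hδ
  have hd : ∀ t ∈ Ioo (-δ) δ, deriv F t = H t + t * deriv H t := by
    intro t ht
    have e : F =ᶠ[𝓝 t] fun t ↦ c + t * H t :=
      Filter.eventually_of_mem (isOpen_Ioo.mem_nhds ht) hF
    rw [e.deriv_eq]
    have h := ((hasDerivAt_id t).mul (ContDiffOn.hasDerivAt_of_Ioo (by simp) hH ht)).const_add c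
    have := h.deriv
    simpa using this
  refine ⟨by simpa using hd 0 h0, ?_⟩
  have e : deriv F =ᶠ[𝓝 0] fun t ↦ H t + t * deriv H t :=
    Filter.eventually_of_mem (isOpen_Ioo.mem_nhds h0) hd
  have hH1 : ContDiffOn ℝ ∞ (deriv H) (Ioo (-δ) δ) := hH.deriv_of_isOpen isOpen_Ioo (by simp)
  rw [iteratedDeriv_succ, iteratedDeriv_one, e.deriv_eq]
  have h := (ContDiffOn.hasDerivAt_of_Ioo (by simp) hH h0).add
    ((hasDerivAt_id (0 : ℝ)).mul (ContDiffOn.hasDerivAt_of_Ioo (by simp) hH1 h0))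
  have := h.deriv
  simp only [id, one_mul, zero_mul, add_zero] at this
  rw [two_mul]
  exact this

/-! ### Smooth solutions of differential equations. -/

/-- A smooth autonomous differential equation has a smooth local solution. -/
theorem exists_smooth_integralCurve {F : Type*} [NormedAddCommGroup F] [NormedSpace ℝ F]
    [CompleteSpace F] {f : F → F} {s : Set F} (hs : IsOpen s) (hf : ContDiffOn ℝ ∞ f s) {y₀ : F}
    (hy : y₀ ∈ s) :
    ∃ δ > 0, ∃ y : ℝ → F, y 0 = y₀ ∧ ContDiffOn ℝ ∞ y (Ioo (-δ) δ) ∧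
      ∀ t ∈ Ioo (-δ) δ, y t ∈ s ∧ HasDerivAt y (f (y t)) t := by
  obtain ⟨y, h0, ε, hε, hd⟩ := ContDiffAt.exists_forall_mem_closedBall_exists_eq_forall_mem_Ioo_hasDerivAt₀
    ((hf.contDiffAt (hs.mem_nhds hy)).of_le (by simp)) 0
  simp only [zero_sub, zero_add] at hd
  have hc : ContinuousAt y 0 := (hd 0 (by simpa using hε)).continuousAt
  obtain ⟨δ, hδ, hle, hsub⟩ :=
    exists_Ioo_symm_subset (hc.preimage_mem_nhds (h0 ▸ hs.mem_nhds hy)) hε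
  have hd' : ∀ t ∈ Ioo (-δ) δ, HasDerivAt y (f (y t)) t :=
    fun t ht ↦ hd t (Ioo_symm_subset hle ht)
  refine ⟨δ, hδ, y, h0, ?_, fun t ht ↦ ⟨hsub ht, hd' t ht⟩⟩
  -- Bootstrapping: if y is Cⁿ then y' = f ∘ y is Cⁿ, so y is Cⁿ⁺¹.
  rw [contDiffOn_infty]
  intro n
  induction n with
  | zero =>
    rw [Nat.cast_zero, contDiffOn_zero]
    exact fun t ht ↦ (hd' t ht).continuousAt.continuousWithinAt
  | succ n ih =>
    rw [Nat.cast_succ, contDiffOn_succ_iff_deriv_of_isOpen isOpen_Ioo]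
    refine ⟨fun t ht ↦ (hd' t ht).differentiableAt.differentiableWithinAt, by simp, ?_⟩
    exact ((hf.of_le (by exact_mod_cast le_top)).comp ih hsub).congr fun t ht ↦ (hd' t ht).deriv

theorem eq_of_hasDerivAt_zero {δ : ℝ} {g : ℝ → ℝ}
    (hg : ∀ t ∈ Ioo (-δ) δ, HasDerivAt g 0 t) {t : ℝ} (ht : t ∈ Ioo (-δ) δ) : g t = g 0 := by
  have h0 : (0 : ℝ) ∈ Ioo (-δ) δ := by
    have := ht.1.trans ht.2
    constructor <;> linarith
  exact isOpen_Ioo.is_const_of_deriv_eq_zero (isPreconnected_Ioo)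
    (fun t ht ↦ (hg t ht).differentiableAt.differentiableWithinAt)
    (fun t ht ↦ (hg t ht).deriv) ht h0

/-! ### Equi-affine structures and framed curves in the coordinate plane. -/

/-- The coordinate plane. -/
abbrev Plane := EuclideanSpace ℝ (Fin 2)

/-- The determinant of two vectors of the coordinate plane. -/
def det2 (v z : Plane) : ℝ := v 0 * z 1 - v 1 * z 0

theorem det2_self (v : Plane) : det2 v v = 0 := by simp only [det2]; ring

theorem det2_plucker (a b c d : Plane) :
    det2 a b * det2 c d - det2 a c * det2 b d + det2 a d * det2 b c = 0 := by
  simp only [det2]; ring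

theorem HasDerivAt.plane_apply {v : ℝ → Plane} {v' : Plane} {t : ℝ} (h : HasDerivAt v v' t)
    (i : Fin 2) : HasDerivAt (fun s ↦ v s i) (v' i) t :=
  (EuclideanSpace.proj (𝕜 := ℝ) i).hasFDerivAt.comp_hasDerivAt t h

theorem HasDerivAt.det2 {v z : ℝ → Plane} {v' z' : Plane} {t : ℝ} (hv : HasDerivAt v v' t)
    (hz : HasDerivAt z z' t) :
    HasDerivAt (fun s ↦ det2 (v s) (z s)) (det2 v' (z t) + det2 (v t) z') t := by
  refine (((HasDerivAt.plane_apply hv 0).mul (HasDerivAt.plane_apply hz 1)).sub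
    ((HasDerivAt.plane_apply hv 1).mul (HasDerivAt.plane_apply hz 0))).congr_deriv ?_
  simp only [EquiAffine.det2]; ring

theorem ContDiffOn.det2 {v z : ℝ → Plane} {s : Set ℝ} (hv : ContDiffOn ℝ ∞ v s)
    (hz : ContDiffOn ℝ ∞ z s) : ContDiffOn ℝ ∞ (fun t ↦ det2 (v t) (z t)) s := by
  have h : ∀ {u : ℝ → Plane}, ContDiffOn ℝ ∞ u s → ∀ i, ContDiffOn ℝ ∞ (fun t ↦ u t i) s :=
    fun hu i ↦ (EuclideanSpace.proj (𝕜 := ℝ) i).contDiff.comp_contDiffOn hu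
  exact ((h hv 0).mul (h hz 1)).sub ((h hv 1).mul (h hz 0))

/-- An equi-affine structure in coordinates: a connection with Christoffel symbols `Γ` and a
parallel area form `w det`, on an open set `V` of the coordinate plane. -/
structure LocalStructure where
  V : Set Plane
  isOpen : IsOpen V
  Γ : Plane → Plane →L[ℝ] Plane →L[ℝ] Plane
  smooth_Γ : ContDiffOn ℝ ∞ Γ V
  w : Plane → ℝ
  smooth_w : ContDiffOn ℝ ∞ w V
  w_ne_zero : ∀ x ∈ V, w x ≠ 0
  parallel : ∀ x ∈ V, ∀ u v z, fderiv ℝ w x u * det2 v z =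
    w x * (det2 (Γ x u v) z + det2 v (Γ x u z))

namespace LocalStructure

/-- The iterated covariant derivatives of the velocity of a curve. -/
def jet (L : LocalStructure) (x : ℝ → Plane) : ℕ → ℝ → Plane
  | 0 => deriv x
  | k + 1 => fun t ↦ deriv (L.jet x k) t + L.Γ (x t) (deriv x t) (L.jet x k t)

/-- The area spanned by two of the iterated covariant derivatives of the velocity. -/
def bracket (L : LocalStructure) (x : ℝ → Plane) (i j : ℕ) (t : ℝ) : ℝ :=
  L.w (x t) * det2 (L.jet x i t) (L.jet x j t)

variable {L : LocalStructure} {δ : ℝ} {x : ℝ → Plane}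

theorem jet_succ (k : ℕ) (t : ℝ) : L.jet x (k + 1) t =
    deriv (L.jet x k) t + L.Γ (x t) (deriv x t) (L.jet x k t) := rfl

theorem contDiffOn_jet (hx : ContDiffOn ℝ ∞ x (Ioo (-δ) δ)) (hV : MapsTo x (Ioo (-δ) δ) L.V)
    (k : ℕ) : ContDiffOn ℝ ∞ (L.jet x k) (Ioo (-δ) δ) := by
  have hx' : ContDiffOn ℝ ∞ (deriv x) (Ioo (-δ) δ) := hx.deriv_of_isOpen isOpen_Ioo (by simp)
  induction k with
  | zero => exact hx'
  | succ k ih =>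
    exact (ih.deriv_of_isOpen isOpen_Ioo (by simp)).add
      (((L.smooth_Γ.comp hx hV).clm_apply hx').clm_apply ih)

theorem contDiffOn_bracket (hx : ContDiffOn ℝ ∞ x (Ioo (-δ) δ))
    (hV : MapsTo x (Ioo (-δ) δ) L.V) (i j : ℕ) :
    ContDiffOn ℝ ∞ (L.bracket x i j) (Ioo (-δ) δ) :=
  (L.smooth_w.comp hx hV).mul (ContDiffOn.det2 (contDiffOn_jet hx hV i) (contDiffOn_jet hx hV j))

/-- The Leibniz rule for Ω along a curve: parallelism of w det absorbs the derivative of w into the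
Christoffel terms. The fields v, z are arbitrary, so it serves both jets and frames. -/
theorem hasDerivAt_area {t : ℝ} {x' : Plane} {v z : ℝ → Plane} {v' z' : Plane} (hV : x t ∈ L.V)
    (hx : HasDerivAt x x' t) (hv : HasDerivAt v v' t) (hz : HasDerivAt z z' t) :
    HasDerivAt (fun s ↦ L.w (x s) * EquiAffine.det2 (v s) (z s))
      (L.w (x t) * EquiAffine.det2 (v' + L.Γ (x t) x' (v t)) (z t) +
        L.w (x t) * EquiAffine.det2 (v t) (z' + L.Γ (x t) x' (z t))) t := by
  have hw : HasFDerivAt L.w (fderiv ℝ L.w (x t)) (x t) :=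
    ((L.smooth_w.contDiffAt (L.isOpen.mem_nhds hV)).differentiableAt (by simp)).hasFDerivAt
  refine ((hw.comp_hasDerivAt t hx).mul (HasDerivAt.det2 hv hz)).congr_deriv ?_
  rw [L.parallel _ hV]
  simp only [EquiAffine.det2, Function.comp, PiLp.add_apply]
  ring

theorem hasDerivAt_bracket (hx : ContDiffOn ℝ ∞ x (Ioo (-δ) δ))
    (hV : MapsTo x (Ioo (-δ) δ) L.V) (i j : ℕ) {t : ℝ} (ht : t ∈ Ioo (-δ) δ) :
    HasDerivAt (L.bracket x i j) (L.bracket x (i + 1) j t + L.bracket x i (j + 1) t) t := by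
  have h := hasDerivAt_area (hV ht) (ContDiffOn.hasDerivAt_of_Ioo (by simp) hx ht)
    (ContDiffOn.hasDerivAt_of_Ioo (by simp) (contDiffOn_jet hx hV i) ht)
    (ContDiffOn.hasDerivAt_of_Ioo (by simp) (contDiffOn_jet hx hV j) ht)
  simp only [← jet_succ] at h
  exact h

theorem bracket_self (i : ℕ) (t : ℝ) : L.bracket x i i t = 0 := by
  rw [bracket, det2_self, mul_zero]

theorem bracket_plucker (i j k l : ℕ) (t : ℝ) :
    L.bracket x i j t * L.bracket x k l t - L.bracket x i k t * L.bracket x j l t +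
      L.bracket x i l t * L.bracket x j k t = 0 := by
  simp only [bracket]
  linear_combination L.w (x t) ^ 2 *
    det2_plucker (L.jet x i t) (L.jet x j t) (L.jet x k t) (L.jet x l t)

variable (L) in
/-- A curve with a unimodular frame `e₁, e₂` along it that satisfies prescribed structure
equations. -/
theorem exists_framed_curve {x₀ : Plane} (hx₀ : x₀ ∈ L.V) (hδ : 0 < δ) {r σ a p : ℝ → ℝ}
    (hr : ContDiffOn ℝ ∞ r (Ioo (-δ) δ)) (hσ : ContDiffOn ℝ ∞ σ (Ioo (-δ) δ))
    (ha : ContDiffOn ℝ ∞ a (Ioo (-δ) δ)) (hp : ContDiffOn ℝ ∞ p (Ioo (-δ) δ)) :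
    ∃ δ' > 0, δ' ≤ δ ∧ ∃ x e₁ e₂ : ℝ → Plane, x 0 = x₀ ∧ ContDiffOn ℝ ∞ x (Ioo (-δ') δ') ∧
      MapsTo x (Ioo (-δ') δ') L.V ∧ ∀ t ∈ Ioo (-δ') δ',
        HasDerivAt x (r t • e₁ t) t ∧
        HasDerivAt e₁ (r t • (a t • e₁ t + σ t • e₂ t) - L.Γ (x t) (r t • e₁ t) (e₁ t)) t ∧
        HasDerivAt e₂ (r t • (p t • e₁ t - a t • e₂ t) - L.Γ (x t) (r t • e₁ t) (e₂ t)) t ∧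
        L.w (x t) * EquiAffine.det2 (e₁ t) (e₂ t) = 1 := by
  -- Time is added as a state variable with derivative 1, which makes the structure equations
  -- autonomous.
  let S := ℝ × Plane × Plane × Plane
  let s : Set S := Ioo (-δ) δ ×ˢ (L.V ×ˢ (univ ×ˢ univ))
  let f : S → S := fun y ↦ (1, r y.1 • y.2.2.1,
    r y.1 • (a y.1 • y.2.2.1 + σ y.1 • y.2.2.2) - L.Γ y.2.1 (r y.1 • y.2.2.1) y.2.2.1,
    r y.1 • (p y.1 • y.2.2.1 - a y.1 • y.2.2.2) - L.Γ y.2.1 (r y.1 • y.2.2.1) y.2.2.2)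
  have hs : IsOpen s := isOpen_Ioo.prod (L.isOpen.prod (isOpen_univ.prod isOpen_univ))
  have hf : ContDiffOn ℝ ∞ f s := by
    have c1 : ContDiffOn ℝ ∞ (fun y : S ↦ y.1) s := contDiff_fst.contDiffOn
    have c2 : ContDiffOn ℝ ∞ (fun y : S ↦ y.2.1) s :=
      (contDiff_fst.comp contDiff_snd).contDiffOn
    have c3 : ContDiffOn ℝ ∞ (fun y : S ↦ y.2.2.1) s :=
      (contDiff_fst.comp (contDiff_snd.comp contDiff_snd)).contDiffOn
    have c4 : ContDiffOn ℝ ∞ (fun y : S ↦ y.2.2.2) s :=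
      (contDiff_snd.comp (contDiff_snd.comp contDiff_snd)).contDiffOn
    have m1 : MapsTo (fun y : S ↦ y.1) s (Ioo (-δ) δ) := fun y hy ↦ hy.1
    have m2 : MapsTo (fun y : S ↦ y.2.1) s L.V := fun y hy ↦ hy.2.1
    have cr := hr.comp c1 m1
    have cu := cr.smul c3
    have cΓ := (L.smooth_Γ.comp c2 m2).clm_apply cu
    exact contDiffOn_const.prodMk (cu.prodMk
      (((cr.smul (((ha.comp c1 m1).smul c3).add ((hσ.comp c1 m1).smul c4))).sub
        (cΓ.clm_apply c3)).prodMk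
      ((cr.smul (((hp.comp c1 m1).smul c3).sub ((ha.comp c1 m1).smul c4))).sub
        (cΓ.clm_apply c4))))
  -- The second vector is scaled so that the initial frame spans area 1.
  let y₀ : S := (0, x₀, !₂[1, 0], !₂[0, (L.w x₀)⁻¹])
  have hy₀ : y₀ ∈ s := ⟨by simpa [y₀] using hδ, hx₀, trivial, trivial⟩
  obtain ⟨δ', hδ', y, h0, hy, hd⟩ := exists_smooth_integralCurve hs hf hy₀
  have hfst : ∀ t ∈ Ioo (-δ') δ', (y t).1 = t := by
    intro t ht
    have h : ∀ t ∈ Ioo (-δ') δ', HasDerivAt (fun t ↦ (y t).1 - t) 0 t := fun t ht ↦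
      (((hasFDerivAt_fst (𝕜 := ℝ)).comp_hasDerivAt t (hd t ht).2).sub
        (hasDerivAt_id t)).congr_deriv (sub_self (1 : ℝ))
    have := eq_of_hasDerivAt_zero h ht
    simp only [h0, y₀, sub_zero] at this
    linarith
  -- The time coordinate equals t and stays in (-δ, δ), so the solution interval cannot extend
  -- beyond it.
  have hle : δ' ≤ δ := by
    by_contra! h
    have ht : δ ∈ Ioo (-δ') δ' := ⟨by linarith, h⟩
    have := (hd δ ht).1.1
    rw [hfst δ ht] at this
    exact lt_irrefl _ this.2
  have key : ∀ t ∈ Ioo (-δ') δ',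
        HasDerivAt (fun t ↦ (y t).2.1) (r t • (y t).2.2.1) t ∧
        HasDerivAt (fun t ↦ (y t).2.2.1) (r t • (a t • (y t).2.2.1 + σ t • (y t).2.2.2)
          - L.Γ (y t).2.1 (r t • (y t).2.2.1) (y t).2.2.1) t ∧
        HasDerivAt (fun t ↦ (y t).2.2.2) (r t • (p t • (y t).2.2.1 - a t • (y t).2.2.2)
          - L.Γ (y t).2.1 (r t • (y t).2.2.1) (y t).2.2.2) t := by
    intro t ht
    have h := (hd t ht).2
    have e := hfst t ht
    have h2 := (hasFDerivAt_snd (𝕜 := ℝ)).comp_hasDerivAt t h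
    have h22 := (hasFDerivAt_snd (𝕜 := ℝ)).comp_hasDerivAt t h2
    have hf1 : (f (y t)).2.1 = r t • (y t).2.2.1 := by simp only [f, e]
    have hf2 : (f (y t)).2.2.1 = r t • (a t • (y t).2.2.1 + σ t • (y t).2.2.2)
          - L.Γ (y t).2.1 (r t • (y t).2.2.1) (y t).2.2.1 := by simp only [f, e]
    have hf3 : (f (y t)).2.2.2 = r t • (p t • (y t).2.2.1 - a t • (y t).2.2.2)
          - L.Γ (y t).2.1 (r t • (y t).2.2.1) (y t).2.2.2 := by simp only [f, e]
    exact ⟨((hasFDerivAt_fst (𝕜 := ℝ)).comp_hasDerivAt t h2).congr_deriv hf1,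
      ((hasFDerivAt_fst (𝕜 := ℝ)).comp_hasDerivAt t h22).congr_deriv hf2,
      ((hasFDerivAt_snd (𝕜 := ℝ)).comp_hasDerivAt t h22).congr_deriv hf3⟩
  refine ⟨δ', hδ', hle, fun t ↦ (y t).2.1, fun t ↦ (y t).2.2.1, fun t ↦ (y t).2.2.2, by simp only [h0, y₀],
    (contDiff_fst.comp contDiff_snd).comp_contDiffOn hy, fun t ht ↦ (hd t ht).1.2.1,
    fun t ht ↦ ⟨(key t ht).1, (key t ht).2.1, (key t ht).2.2, ?_⟩⟩
  -- The coefficient matrix of the structure equations has trace r(a - a) = 0, so the area of the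
  -- frame is constant.
  have hW : ∀ t ∈ Ioo (-δ') δ', HasDerivAt
      (fun t ↦ L.w (y t).2.1 * EquiAffine.det2 (y t).2.2.1 (y t).2.2.2) 0 t := fun t ht ↦
    (hasDerivAt_area (hd t ht).1.2.1 (key t ht).1 (key t ht).2.1 (key t ht).2.2).congr_deriv (by
      simp only [EquiAffine.det2, sub_add_cancel, PiLp.add_apply, PiLp.sub_apply, PiLp.smul_apply,
        smul_eq_mul]
      ring)
  rw [eq_of_hasDerivAt_zero hW ht, h0]
  have := L.w_ne_zero x₀ hx₀
  simp [EquiAffine.det2, y₀, this]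

end LocalStructure

/-! ### Realizing a prescribed normalized curvature. -/

namespace LocalStructure

variable {L : LocalStructure} {δ : ℝ} {x e₁ e₂ : ℝ → Plane} {r σ a p : ℝ → ℝ}

theorem bracket_of_frame {i j : ℕ} {t α β α' β' : ℝ}
    (hu : L.w (x t) * det2 (e₁ t) (e₂ t) = 1)
    (hi : L.jet x i t = α • e₁ t + β • e₂ t) (hj : L.jet x j t = α' • e₁ t + β' • e₂ t) :
    L.bracket x i j t = α * β' - β * α' := by
  rw [bracket, hi, hj]
  simp only [det2, PiLp.add_apply, PiLp.smul_apply, smul_eq_mul] at hu ⊢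
  linear_combination (α * β' - β * α') * hu

theorem jet_succ_of_frame
    (hx : ∀ t ∈ Ioo (-δ) δ, HasDerivAt x (r t • e₁ t) t)
    (h1 : ∀ t ∈ Ioo (-δ) δ, HasDerivAt e₁
      (r t • (a t • e₁ t + σ t • e₂ t) - L.Γ (x t) (r t • e₁ t) (e₁ t)) t)
    (h2 : ∀ t ∈ Ioo (-δ) δ, HasDerivAt e₂
      (r t • (p t • e₁ t - a t • e₂ t) - L.Γ (x t) (r t • e₁ t) (e₂ t)) t)
    {k : ℕ} {α β α' β' : ℝ → ℝ}
    (hα : ∀ t ∈ Ioo (-δ) δ, HasDerivAt α (α' t) t) (hβ : ∀ t ∈ Ioo (-δ) δ, HasDerivAt β (β' t) t)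
    (hk : ∀ t ∈ Ioo (-δ) δ, L.jet x k t = α t • e₁ t + β t • e₂ t) {t : ℝ}
    (ht : t ∈ Ioo (-δ) δ) :
    L.jet x (k + 1) t = (α' t + r t * (α t * a t + β t * p t)) • e₁ t +
      (β' t + r t * (α t * σ t - β t * a t)) • e₂ t := by
  have e : L.jet x k =ᶠ[𝓝 t] fun t ↦ α t • e₁ t + β t • e₂ t :=
    Filter.eventually_of_mem (isOpen_Ioo.mem_nhds ht) hk
  have hd := ((hα t ht).smul (h1 t ht)).add ((hβ t ht).smul (h2 t ht))
  have hd' : deriv (L.jet x k) t = _ := e.deriv_eq.trans hd.deriv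
  rw [jet_succ, hd', (hx t ht).deriv, hk t ht, map_add, map_smul (L.Γ (x t) _) (α t),
    map_smul (L.Γ (x t) _) (β t)]
  module

end LocalStructure

/-- With h = H(0), h' = H'(0), q = 1 + k t/2 and a = 16H/(9q), the displayed expression is a'(0) +
a(0)². It depends on k only through k h, whence the two cases. -/
theorem exists_compatible_coefficient {h h' : ℝ} (hh : h ≠ 0 ∨ (h = 0 ∧ h' = 0)) :
    ∃ k : ℝ, 16 / 9 * (h' - k * h / 2) + (16 * h / 9) ^ 2 = 0 := by
  rcases hh with hh | ⟨rfl, rfl⟩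
  · refine ⟨2 * (h' + 9 / 16 * (16 * h / 9) ^ 2) / h, ?_⟩
    field_simp
    ring
  · exact ⟨0, by norm_num⟩

/-- Every admissible germ is the normalized affine curvature function of a curve with a generic
inflection point. -/
theorem LocalStructure.exists_curve_normalizedQuotient (L : LocalStructure) {x₀ : Plane}
    (hx₀ : x₀ ∈ L.V) {δ : ℝ} (hδ : 0 < δ) {H : ℝ → ℝ} (hH : ContDiffOn ℝ ∞ H (Ioo (-δ) δ))
    (h0 : H 0 ≠ 0 ∨ (H 0 = 0 ∧ deriv H 0 = 0)) :
    ∃ δ' > 0, δ' ≤ δ ∧ ∃ x : ℝ → Plane, x 0 = x₀ ∧ ContDiffOn ℝ ∞ x (Ioo (-δ') δ') ∧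
      MapsTo x (Ioo (-δ') δ') L.V ∧ deriv x 0 ≠ 0 ∧ L.bracket x 0 1 0 = 0 ∧
      L.bracket x 0 2 0 ≠ 0 ∧ ∀ t ∈ Ioo (-δ') δ', t ≠ 0 →
        normalizedQuotient (L.bracket x 0 1) (L.bracket x 0 2) (L.bracket x 0 3)
          (L.bracket x 1 2) t = -5 / 16 + t * H t := by
  obtain ⟨k, hk⟩ := exists_compatible_coefficient h0
  have hev : ∀ c : ℝ, ∀ᶠ t in 𝓝 (0 : ℝ), 0 < 1 + c * t := fun c ↦
    (show Continuous fun t : ℝ ↦ 1 + c * t by fun_prop).continuousAt.eventually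
      (lt_mem_nhds (by simp))
  obtain ⟨δ₁, hδ₁, hle₁, hsub⟩ := exists_Ioo_symm_subset ((hev k).and (hev (k / 2))) hδ
  set q : ℝ → ℝ := fun t ↦ 1 + k / 2 * t with hqdef
  set r : ℝ → ℝ := fun t ↦ 1 + k * t with hrdef
  set σ : ℝ → ℝ := fun t ↦ t * q t with hσdef
  have hr0 : ∀ t ∈ Ioo (-δ₁) δ₁, 0 < r t := fun t ht ↦ (hsub ht).1
  have hq0 : ∀ t ∈ Ioo (-δ₁) δ₁, 0 < q t := fun t ht ↦ (hsub ht).2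
  have sq : ContDiff ℝ ∞ q := by fun_prop
  have sr : ContDiff ℝ ∞ r := by fun_prop
  have sσ : ContDiff ℝ ∞ σ := by fun_prop
  have hσd : ∀ t, HasDerivAt σ (r t) t := fun t ↦
    ((hasDerivAt_id t).mul (((hasDerivAt_id t).const_mul (k / 2)).const_add 1)).congr_deriv
      (by simp only [id, hrdef]; ring)
  have hrd : ∀ t, HasDerivAt r k t := fun t ↦
    (((hasDerivAt_id t).const_mul k).const_add 1).congr_deriv (by ring)
  have hz : (0 : ℝ) ∈ Ioo (-δ₁) δ₁ := by simpa using hδ₁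
  -- Forced by the target: once [γ̈, γ⁽³⁾] has the form `B12`, its summand 3 r k² σ cancels the -3
  -- r₁² term of `reducedCurvature`, leaving H = (9/16) q a.
  set a : ℝ → ℝ := fun t ↦ 16 / 9 * H t / q t with hadef
  have hH₁ := hH.mono (Ioo_symm_subset hle₁)
  have sa : ContDiffOn ℝ ∞ a (Ioo (-δ₁) δ₁) :=
    (contDiffOn_const.mul hH₁).div sq.contDiffOn fun t ht ↦ (hq0 t ht).ne'
  have sa' : ContDiffOn ℝ ∞ (deriv a) (Ioo (-δ₁) δ₁) := sa.deriv_of_isOpen isOpen_Ioo (by simp)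
  have sN : ContDiffOn ℝ ∞ (fun t ↦ deriv a t / r t + a t ^ 2) (Ioo (-δ₁) δ₁) :=
    (sa'.div sr.contDiffOn fun t ht ↦ (hr0 t ht).ne').add (sa.pow 2)
  have hN0 : deriv a 0 / r 0 + a 0 ^ 2 = 0 := by
    have hd : HasDerivAt a _ 0 :=
      ((ContDiffOn.hasDerivAt_of_Ioo (by simp) hH₁ hz).const_mul (16 / 9)).div
        (((hasDerivAt_id (0 : ℝ)).const_mul (k / 2)).const_add 1) (hq0 0 hz).ne'
    rw [hd.deriv]
    simp only [hadef, hqdef, hrdef]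
    linear_combination hk
  -- Dividing by σ = t q gives the smooth p = -n/q with σ p = -(a'/r + a²). This choice removes a'
  -- and a² from the e₁-component of γ⁽³⁾.
  obtain ⟨n, sn, hn⟩ := exists_smooth_eq_mul sN hN0
  have sp : ContDiffOn ℝ ∞ (fun t ↦ -n t / q t) (Ioo (-δ₁) δ₁) :=
    sn.neg.div sq.contDiffOn fun t ht ↦ (hq0 t ht).ne'
  obtain ⟨δ', hδ', hle, x, e₁, e₂, hx0, sx, hxV, hf⟩ :=
    L.exists_framed_curve hx₀ hδ₁ sr.contDiffOn sσ.contDiffOn sa sp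
  have hI : Ioo (-δ') δ' ⊆ Ioo (-δ₁) δ₁ := Ioo_symm_subset hle
  have hz' : (0 : ℝ) ∈ Ioo (-δ') δ' := by simpa using hδ'
  have f1 := fun t ht ↦ (hf t ht).1
  have f2 := fun t ht ↦ (hf t ht).2.1
  have f3 := fun t ht ↦ (hf t ht).2.2.1
  have f4 := fun t ht ↦ (hf t ht).2.2.2
  have had : ∀ t ∈ Ioo (-δ') δ', HasDerivAt a (deriv a t) t :=
    fun t ht ↦ ContDiffOn.hasDerivAt_of_Ioo (by simp) sa (hI ht)
  have J0 : ∀ t ∈ Ioo (-δ') δ', L.jet x 0 t = r t • e₁ t + (0 : ℝ) • e₂ t := by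
    intro t ht
    rw [zero_smul, add_zero]
    exact (f1 t ht).deriv
  have J1 : ∀ t ∈ Ioo (-δ') δ', L.jet x 1 t =
      (k + r t ^ 2 * a t) • e₁ t + (r t ^ 2 * σ t) • e₂ t := by
    intro t ht
    rw [LocalStructure.jet_succ_of_frame f1 f2 f3 (fun t _ ↦ hrd t)
      (fun t _ ↦ hasDerivAt_const t (0 : ℝ)) J0 ht]
    congr 2 <;> ring
  have J2 : ∀ t ∈ Ioo (-δ') δ', L.jet x 2 t = (3 * r t * k * a t) • e₁ t +
      (3 * r t * k * σ t + r t ^ 3) • e₂ t := by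
    intro t ht
    rw [LocalStructure.jet_succ_of_frame f1 f2 f3
      (fun t ht ↦ ((((hrd t).pow 2).mul (had t ht)).const_add k))
      (fun t _ ↦ ((hrd t).pow 2).mul (hσd t)) J1 ht]
    have hr := hr0 t (hI ht)
    have hq := hq0 t (hI ht)
    have hp : σ t * (-n t / q t) = -(deriv a t / r t + a t ^ 2) := by
      rw [hn t (hI ht)]
      simp only [hσdef]
      field_simp
    simp only [Pi.pow_apply, Pi.mul_apply]
    clear_value q r σ a
    congr 2
    · have e : r t * (r t ^ 2 * σ t * (-n t / q t)) = -(r t ^ 2 * deriv a t + r t ^ 3 * a t ^ 2) := by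
        rw [mul_assoc (r t ^ 2), hp]
        field_simp
      push_cast
      linear_combination e
    · push_cast; ring
  have B01 : ∀ t ∈ Ioo (-δ') δ', L.bracket x 0 1 t = 1 * (σ t * r t ^ 3) := fun t ht ↦
    (LocalStructure.bracket_of_frame (f4 t ht) (J0 t ht) (J1 t ht)).trans (by ring)
  have B12 : ∀ t ∈ Ioo (-δ') δ', L.bracket x 1 2 t =
      r t ^ 3 * k + r t ^ 5 * a t + 3 * r t * k ^ 2 * σ t := fun t ht ↦
    (LocalStructure.bracket_of_frame (f4 t ht) (J1 t ht) (J2 t ht)).trans (by ring)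
  refine ⟨δ', hδ', hle.trans hle₁, x, hx0, sx, hxV, ?_, ?_, ?_, fun t ht ht0 ↦ ?_⟩
  · rw [(f1 0 hz').deriv]
    intro h
    have h4 := f4 0 hz'
    have : e₁ 0 = 0 := by simpa [hrdef] using h
    rw [this] at h4
    simp [det2] at h4
  · rw [B01 0 hz']
    simp [hσdef]
  · rw [LocalStructure.bracket_of_frame (f4 0 hz') (J0 0 hz') (J2 0 hz')]
    simp [hσdef, hrdef]
  · have h13 : ∀ t ∈ Ioo (-δ') δ', HasDerivAt (L.bracket x 0 1) (L.bracket x 0 2 t) t :=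
      fun t ht ↦ (LocalStructure.hasDerivAt_bracket sx hxV 0 1 ht).congr_deriv
        (by rw [LocalStructure.bracket_self, zero_add])
    have h14 : ∀ t ∈ Ioo (-δ') δ', HasDerivAt (L.bracket x 0 2)
        (L.bracket x 1 2 t + L.bracket x 0 3 t) t :=
      fun t ht ↦ LocalStructure.hasDerivAt_bracket sx hxV 0 2 ht
    have h := sq_arclength_mul_curvature (q := q) (fun t _ ↦ hσd t) (fun t _ ↦ hrd t)
      (fun t _ ↦ hasDerivAt_const t k) B01 h13 h14 (Or.inl rfl) (fun _ _ ↦ rfl)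
      (fun t ht ↦ hq0 t (hI ht)) (fun t ht ↦ hr0 t (hI ht)) ht ht0
    refine h.trans ?_
    have hr := hr0 t (hI ht)
    have hq := hq0 t (hI ht)
    rw [reducedCurvature, B12 t ht]
    simp only [hadef, hσdef]
    field_simp
    ring

/-! ### Chart frames and the covariant derivative along a curve on the surface. -/

variable {M : Type*} [TopologicalSpace M] [ChartedSpace (EuclideanSpace ℝ (Fin 2)) M]

theorem hasDerivAt_comp_curve {F : Type*} [NormedAddCommGroup F] [NormedSpace ℝ F] {f : M → F}
    {γ : ℝ → M} {t : ℝ} (hf : MDifferentiableAt (𝓡 2) 𝓘(ℝ, F) f (γ t))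
    (hγ : MDifferentiableAt 𝓘(ℝ, ℝ) (𝓡 2) γ t) :
    HasDerivAt (fun s ↦ f (γ s)) (mvfderiv (𝓡 2) f (γ t) (velocity γ t)) t := by
  have h : HasFDerivAt (𝕜 := ℝ) (E := ℝ) (F := F) (fun s ↦ f (γ s)) _ t :=
    (hf.hasMFDerivAt.comp t hγ.hasMFDerivAt).hasFDerivAt
  exact h.hasDerivAt

theorem chart_source_mem_nhds {p q : M} (hq : q ∈ (chartAt Plane p).source) :
    (chartAt Plane p).source ∈ 𝓝 q :=
  (chartAt Plane p).open_source.mem_nhds hq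

variable [IsManifold (𝓡 2) ∞ M]

theorem contMDiffVectorBundle_tangentSpace :
    ContMDiffVectorBundle ∞ Plane (TangentSpace (𝓡 2) : M → Type _) (𝓡 2) :=
  haveI : IsManifold (𝓡 2) (∞ + 1) M := by simpa using ‹IsManifold (𝓡 2) ∞ M›
  inferInstance

/-- The coordinates of tangent vectors at `q`, in the frame of the preferred chart at `p`. -/
def tangentCoord (p q : M) : TangentSpace (𝓡 2) q →L[ℝ] Plane :=
  (trivializationAt Plane (TangentSpace (𝓡 2) : M → Type _) p).continuousLinearMapAt ℝ q

/-- The tangent vector at `q` with given coordinates in the frame of the preferred chart at `p`. -/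
def tangentOfCoord (p q : M) : Plane →L[ℝ] TangentSpace (𝓡 2) q :=
  (trivializationAt Plane (TangentSpace (𝓡 2) : M → Type _) p).symmL ℝ q

theorem tangentOfCoord_apply {p q : M} (hq : q ∈ (chartAt Plane p).source) (v : Plane) :
    tangentOfCoord p q v =
      (trivializationAt Plane (TangentSpace (𝓡 2) : M → Type _) p).symm q v :=
  Trivialization.symmL_apply _ hq v

theorem tangentCoord_apply {p q : M} (hq : q ∈ (chartAt Plane p).source)
    (v : TangentSpace (𝓡 2) q) : tangentCoord p q v =
    (trivializationAt Plane (TangentSpace (𝓡 2) : M → Type _) p ⟨q, v⟩).2 := by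
  rw [tangentCoord, Trivialization.continuousLinearMapAt_apply_of_mem _ _ hq]

theorem tangentCoord_ofCoord {p q : M} (hq : q ∈ (chartAt Plane p).source) (v : Plane) :
    tangentCoord p q (tangentOfCoord p q v) = v :=
  Trivialization.continuousLinearMapAt_symmL _ hq v

theorem tangentOfCoord_coord {p q : M} (hq : q ∈ (chartAt Plane p).source)
    (v : TangentSpace (𝓡 2) q) : tangentOfCoord p q (tangentCoord p q v) = v :=
  Trivialization.symmL_continuousLinearMapAt _ hq v

theorem mfderiv_extChartAt_eq_tangentCoord {p q : M} (hq : q ∈ (chartAt Plane p).source)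
    (v : TangentSpace (𝓡 2) q) :
    mvfderiv (𝓡 2) (extChartAt (𝓡 2) p) q v = tangentCoord p q v := by
  rw [tangentCoord, TangentBundle.continuousLinearMapAt_trivializationAt hq]
  rfl

theorem contMDiffOn_tangentOfCoord (p : M) (v : Plane) :
    ContMDiffOn (𝓡 2) (𝓡 2).tangent ∞
      (fun q ↦ (⟨q, tangentOfCoord p q v⟩ : TangentBundle (𝓡 2) M)) (chartAt Plane p).source := by
  have := contMDiffVectorBundle_tangentSpace (M := M)
  refine ((trivializationAt Plane (TangentSpace (𝓡 2) : M → Type _)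
    p).contMDiffOn_section_baseSet_iff).2 ?_
  refine contMDiffOn_const (c := v) |>.congr fun q hq ↦ ?_
  exact (tangentCoord_apply hq _).symm.trans (tangentCoord_ofCoord hq v)

theorem mdifferentiableAt_tangentOfCoord {p q : M} (hq : q ∈ (chartAt Plane p).source)
    (v : Plane) : MDifferentiableAt (𝓡 2) (𝓡 2).tangent
      (fun q ↦ (⟨q, tangentOfCoord p q v⟩ : TangentBundle (𝓡 2) M)) q :=
  ((contMDiffOn_tangentOfCoord p v).contMDiffAt
    ((chartAt Plane p).open_source.mem_nhds hq)).mdifferentiableAt (by simp)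

theorem plane_eq_sum (v : Plane) :
    v = v 0 • EuclideanSpace.single 0 (1 : ℝ) + v 1 • EuclideanSpace.single 1 (1 : ℝ) := by
  ext i
  fin_cases i <;> simp

/-- The Leibniz rule in the frame of the preferred chart at `p`. -/
theorem conn_tangentOfCoord (S : Structure M) {p q : M} (hq : q ∈ (chartAt Plane p).source)
    {B : M → Plane} (hB : MDifferentiableAt (𝓡 2) 𝓘(ℝ, Plane) B q) (u : TangentSpace (𝓡 2) q) :
    S.conn (fun y ↦ tangentOfCoord p y (B y)) q u =
      B q 0 • S.conn (fun y ↦ tangentOfCoord p y (EuclideanSpace.single 0 1)) q u +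
      B q 1 • S.conn (fun y ↦ tangentOfCoord p y (EuclideanSpace.single 1 1)) q u +
      tangentOfCoord p q (mvfderiv (𝓡 2) B q u) := by
  have hc := S.conn.isCovariantDerivativeOnUniv
  have hi : ∀ i : Fin 2, MDifferentiableAt (𝓡 2) 𝓘(ℝ, ℝ) (fun y ↦ B y i) q := fun i ↦
    (EuclideanSpace.proj (𝕜 := ℝ) i).mdifferentiableAt.comp q hB
  have hd : ∀ i : Fin 2, mvfderiv (𝓡 2) (fun y ↦ B y i) q u = (mvfderiv (𝓡 2) B q u) i := by
    intro i
    have := ((EuclideanSpace.proj (𝕜 := ℝ) i).hasMFDerivAt.comp q hB.hasMFDerivAt).mfderiv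
    exact congrArg (fun L : Plane →L[ℝ] ℝ ↦ L u) this
  have hs := fun i : Fin 2 ↦ mdifferentiableAt_tangentOfCoord hq (EuclideanSpace.single i (1 : ℝ))
  have e : (fun y ↦ tangentOfCoord p y (B y)) =
      (fun y ↦ B y 0) • (fun y ↦ tangentOfCoord p y (EuclideanSpace.single 0 1)) +
      (fun y ↦ B y 1) • (fun y ↦ tangentOfCoord p y (EuclideanSpace.single 1 1)) := by
    funext y
    conv_lhs => rw [plane_eq_sum (B y)]
    rw [map_add, map_smul, map_smul]
    rfl
  rw [e, hc.add ((hi 0).smul_section (hs 0)) ((hi 1).smul_section (hs 1)),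
    hc.leibniz (hs 0) (hi 0), hc.leibniz (hs 1) (hi 1)]
  conv_rhs => rw [plane_eq_sum (mvfderiv (𝓡 2) B q u)]
  rw [map_add, map_smul, map_smul, ← hd 0, ← hd 1]
  simp only [add_apply, smul_apply,
    ContinuousLinearMap.smulRight_apply]
  abel

/-- The trivialization and its linear coordinate maps agree only over the chart domain. Locality of
the derivative and of the connection makes that sufficient. -/
theorem covAlong_eq (S : Structure M) {γ : ℝ → M} (V : ∀ t, TangentSpace (𝓡 2) (γ t)) {t : ℝ}
    (hγ : ContinuousAt γ t) :
    S.covAlong γ V t =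
      tangentOfCoord (γ t) (γ t) (deriv (fun s ↦ tangentCoord (γ t) (γ s) (V s)) t) +
      S.conn (fun y ↦ tangentOfCoord (γ t) y (tangentCoord (γ t) (γ t) (V t))) (γ t)
        (velocity γ t) := by
  have hq : γ t ∈ (chartAt Plane (γ t)).source := mem_chart_source _ _
  have hd : (fun s ↦ tangentCoord (γ t) (γ s) (V s)) =ᶠ[𝓝 t]
      fun s ↦ (trivializationAt Plane (TangentSpace (𝓡 2) : M → Type _) (γ t) ⟨γ s, V s⟩).2 :=
    Filter.mem_of_superset (hγ (chart_source_mem_nhds hq)) fun s hs ↦ tangentCoord_apply hs _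
  have he : ∀ v : Plane, ∀ᶠ y in 𝓝 (γ t), tangentOfCoord (γ t) y v =
      (trivializationAt Plane (TangentSpace (𝓡 2) : M → Type _) (γ t)).symm y v := fun v ↦
    Filter.mem_of_superset (chart_source_mem_nhds hq) fun y hy ↦ tangentOfCoord_apply hy v
  rw [hd.deriv_eq, tangentOfCoord_apply hq, tangentCoord_apply hq]
  have hm := mdifferentiableAt_tangentOfCoord hq
    (trivializationAt Plane (TangentSpace (𝓡 2) : M → Type _) (γ t) ⟨γ t, V t⟩).2
  have := he (trivializationAt Plane (TangentSpace (𝓡 2) : M → Type _) (γ t) ⟨γ t, V t⟩).2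
  have hm' := hm.congr_of_eventuallyEq (this.mono fun y hy ↦
    congrArg (TotalSpace.mk' Plane (E := (TangentSpace (𝓡 2) : M → Type _)) y) hy.symm)
  rw [S.conn.isCovariantDerivativeOnUniv.congr_of_eventuallyEq hm hm' univ_mem this]
  rfl

/-- The change of frame between the preferred charts at `p` and at `p'`. -/
def frameChange (p p' q : M) : Plane →L[ℝ] Plane :=
  (tangentCoord p' q).comp (tangentOfCoord p q)

theorem mdifferentiableAt_frameChange {p p' q : M} (hq : q ∈ (chartAt Plane p).source)
    (hq' : q ∈ (chartAt Plane p').source) :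
    MDifferentiableAt (𝓡 2) 𝓘(ℝ, Plane →L[ℝ] Plane) (frameChange p p') q := by
  have := contMDiffVectorBundle_tangentSpace (M := M)
  have h : MDifferentiableAt (𝓡 2) 𝓘(ℝ, Plane →L[ℝ] Plane) _ q :=
    (contMDiffAt_coordChangeL (n := ∞) (IB := 𝓡 2)
      (e := trivializationAt Plane (TangentSpace (𝓡 2) : M → Type _) p)
      (e' := trivializationAt Plane (TangentSpace (𝓡 2) : M → Type _) p') hq hq').mdifferentiableAt
      (by simp)
  refine h.congr_of_eventuallyEq ?_
  filter_upwards [chart_source_mem_nhds hq, chart_source_mem_nhds hq'] with y hy hy'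
  ext1 v
  rw [frameChange, ContinuousLinearMap.comp_apply, tangentCoord_apply hy', tangentOfCoord_apply hy]
  exact (Trivialization.coordChangeL_apply _ _ ⟨hy, hy'⟩ v).symm

/-- The covariant derivative along a curve can be computed in the frame of any preferred chart. -/
theorem tangentCoord_covAlong (S : Structure M) {γ : ℝ → M} {V : ∀ t, TangentSpace (𝓡 2) (γ t)}
    {t : ℝ} {p : M} (hp : γ t ∈ (chartAt Plane p).source)
    (hγ : MDifferentiableAt 𝓘(ℝ, ℝ) (𝓡 2) γ t)
    (hV : DifferentiableAt ℝ (fun s ↦ tangentCoord p (γ s) (V s)) t) :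
    tangentCoord p (γ t) (S.covAlong γ V t) = deriv (fun s ↦ tangentCoord p (γ s) (V s)) t +
      tangentCoord p (γ t) (S.conn (fun y ↦ tangentOfCoord p y (tangentCoord p (γ t) (V t))) (γ t)
        (velocity γ t)) := by
  have hq : γ t ∈ (chartAt Plane (γ t)).source := mem_chart_source _ _
  set q := γ t with hqdef
  set v : ℝ → Plane := fun s ↦ tangentCoord p (γ s) (V s) with hv
  set C := frameChange p q with hC
  have hCd := mdifferentiableAt_frameChange hp hq
  have hD := hasDerivAt_comp_curve hCd hγ
  -- Freezing coefficients in the frame at p gives, in the frame at q, the variable coefficients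
  -- C(y) v(t). The Leibniz rule for the connection then yields the term C' v, which is also the
  -- extra term in the derivative of C(γ) v.
  have hB : MDifferentiableAt (𝓡 2) 𝓘(ℝ, Plane) (fun y ↦ C y (v t)) q :=
    hCd.clm_apply mdifferentiableAt_const
  have hBD := hasDerivAt_comp_curve hB hγ
  have hBv := hBD.unique (hD.clm_apply (hasDerivAt_const t (v t)))
  simp only [map_zero, add_zero] at hBv
  have hve : (fun s ↦ tangentCoord q (γ s) (V s)) =ᶠ[𝓝 t] fun s ↦ C (γ s) (v s) := by
    filter_upwards [hγ.continuousAt (chart_source_mem_nhds hp)] with s hs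
    simp only [hC, frameChange, ContinuousLinearMap.comp_apply, hv]
    rw [tangentOfCoord_coord hs]
  have hsec : ∀ᶠ y in 𝓝 q, tangentOfCoord p y (v t) = tangentOfCoord q y (C y (v t)) := by
    filter_upwards [chart_source_mem_nhds hq] with y hy
    simp only [hC, frameChange, ContinuousLinearMap.comp_apply]
    rw [tangentOfCoord_coord hy]
  have hm := mdifferentiableAt_tangentOfCoord hp (v t)
  have hm' := hm.congr_of_eventuallyEq (hsec.mono fun y hy ↦
    congrArg (TotalSpace.mk' Plane (E := (TangentSpace (𝓡 2) : M → Type _)) y) hy.symm)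
  have hconn := S.conn.isCovariantDerivativeOnUniv.congr_of_eventuallyEq hm hm' univ_mem hsec
  have hcst : MDifferentiableAt (𝓡 2) 𝓘(ℝ, Plane) (fun _ : M ↦ tangentCoord q q (V t)) q :=
    mdifferentiableAt_const
  have hCv : tangentCoord q q (V t) = C q (v t) := hve.self_of_nhds
  rw [hconn, conn_tangentOfCoord S hq hB, covAlong_eq S V hγ.continuousAt,
    conn_tangentOfCoord S hq hcst, hve.deriv_eq, (hD.clm_apply hV.hasDerivAt).deriv, hBv]
  simp only [mvfderiv_const]
  rw [hCv]
  have hfin : tangentCoord p q (tangentOfCoord q q (C q (deriv v t))) = deriv v t := by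
    simp only [hC, frameChange, ContinuousLinearMap.comp_apply]
    rw [tangentOfCoord_coord hq, tangentCoord_ofCoord hp]
  conv_rhs => rw [← hfin]
  rw [← map_add]
  congr 1
  simp only [map_add, zero_apply, map_zero, add_zero]
  abel

/-! ### Passing to a local structure by means of cut-off coordinate fields. -/

/-- A globally smooth vector field that has constant coordinates near `p`, in the frame of the
preferred chart at `p`. -/
def bumpField {p : M} (χ : SmoothBumpFunction (𝓡 2) p) (v : Plane) (q : M) :
    TangentSpace (𝓡 2) q :=
  χ q • tangentOfCoord p q v

theorem contMDiff_bumpField [T2Space M] {p : M} (χ : SmoothBumpFunction (𝓡 2) p) (v : Plane) :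
    ContMDiff (𝓡 2) (𝓡 2).tangent ∞
      (fun q ↦ (⟨q, bumpField χ v q⟩ : TangentBundle (𝓡 2) M)) := by
  have := contMDiffVectorBundle_tangentSpace (M := M)
  exact ContMDiffOn.smul_section_of_tsupport χ.contMDiff.contMDiffOn
    (chartAt Plane p).open_source χ.tsupport_subset_chartAt_source
    (contMDiffOn_tangentOfCoord p v)

/-- Provides smoothness of the Christoffel symbols, which are the coordinates of these fields where
χ = 1. -/
theorem contMDiff_conn_bumpField [T2Space M] (S : Structure M) {p : M}
    (χ : SmoothBumpFunction (𝓡 2) p) (u v : Plane) :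
    ContMDiff (𝓡 2) (𝓡 2).tangent ∞
      (fun q ↦ (⟨q, S.conn (bumpField χ v) q (bumpField χ u q)⟩ : TangentBundle (𝓡 2) M)) := by
  have h := S.smooth_conn.contMDiff.contMDiff (σ := bumpField χ v)
    (by simpa using (contMDiff_bumpField χ v).contMDiffOn)
  rw [contMDiffOn_univ] at h
  exact ContMDiff.clm_bundle_apply h (contMDiff_bumpField χ u)

theorem contMDiff_form_bumpField [T2Space M] (S : Structure M) {p : M}
    (χ : SmoothBumpFunction (𝓡 2) p) (u v : Plane) :
    ContMDiff (𝓡 2) 𝓘(ℝ, ℝ) ∞ (fun q ↦ S.form q (bumpField χ u q) (bumpField χ v q)) := by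
  have h : ContMDiff (𝓡 2) ((𝓡 2).prod 𝓘(ℝ, ℝ)) ∞
      (fun q ↦ TotalSpace.mk' ℝ (E := Bundle.Trivial M ℝ) q
        (S.form q (bumpField χ u q) (bumpField χ v q))) :=
    ContMDiff.clm_bundle_apply₂ (F₁ := Plane) (F₂ := Plane) S.smooth_form
      (contMDiff_bumpField χ u) (contMDiff_bumpField χ v)
  intro q
  have := contMDiffAt_totalSpace.1 (h q)
  exact this.2

theorem contMDiffOn_tangentCoord {p : M} {Y : ∀ q : M, TangentSpace (𝓡 2) q}
    (hY : ContMDiff (𝓡 2) (𝓡 2).tangent ∞ (fun q ↦ (⟨q, Y q⟩ : TangentBundle (𝓡 2) M))) :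
    ContMDiffOn (𝓡 2) 𝓘(ℝ, Plane) ∞ (fun q ↦ tangentCoord p q (Y q)) (chartAt Plane p).source := by
  have := contMDiffVectorBundle_tangentSpace (M := M)
  refine (((trivializationAt Plane (TangentSpace (𝓡 2) : M → Type _)
    p).contMDiffOn_section_baseSet_iff).1 hY.contMDiffOn).congr fun q hq ↦ ?_
  exact tangentCoord_apply hq _

theorem contDiffOn_comp_chart_symm {F : Type*} [NormedAddCommGroup F] [NormedSpace ℝ F] {p : M}
    {f : M → F} (hf : ContMDiffOn (𝓡 2) 𝓘(ℝ, F) ∞ f (chartAt Plane p).source) :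
    ContDiffOn ℝ ∞ (fun x ↦ f ((chartAt Plane p).symm x)) (chartAt Plane p).target := by
  rw [← contMDiffOn_iff_contDiffOn]
  exact hf.comp (contMDiffOn_chart_symm (I := 𝓡 2)) fun x hx ↦ (chartAt Plane p).map_target hx

theorem form_swap (S : Structure M) (q : M) (v z : TangentSpace (𝓡 2) q) :
    S.form q z v = -S.form q v z := by
  have h := S.form_self q (v + z)
  simp only [map_add, add_apply, S.form_self] at h
  linarith

theorem form_map (S : Structure M) (q : M) (A : Plane →L[ℝ] TangentSpace (𝓡 2) q) (v z : Plane) :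
    S.form q (A v) (A z) =
      S.form q (A (EuclideanSpace.single 0 1)) (A (EuclideanSpace.single 1 1)) * det2 v z := by
  conv_lhs => rw [plane_eq_sum v, plane_eq_sum z]
  simp only [map_add, map_smul, add_apply, smul_apply, S.form_self, smul_eq_mul,
    form_swap S q (A (EuclideanSpace.single 0 1)) (A (EuclideanSpace.single 1 1)), det2]
  ring

theorem form_bumpField (S : Structure M) {p : M} (χ : SmoothBumpFunction (𝓡 2) p) (q : M)
    (v z : Plane) : S.form q (bumpField χ v q) (bumpField χ z q) =
      S.form q (bumpField χ (EuclideanSpace.single 0 1) q)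
        (bumpField χ (EuclideanSpace.single 1 1) q) * det2 v z :=
  form_map S q (χ q • tangentOfCoord p q) v z

theorem conn_congr (S : Structure M) {Y Z : ∀ q : M, TangentSpace (𝓡 2) q} {q : M}
    (hY : MDifferentiableAt (𝓡 2) (𝓡 2).tangent
      (fun q ↦ (⟨q, Y q⟩ : TangentBundle (𝓡 2) M)) q) (h : ∀ᶠ y in 𝓝 q, Y y = Z y) :
    S.conn Y q = S.conn Z q :=
  S.conn.isCovariantDerivativeOnUniv.congr_of_eventuallyEq hY
    (hY.congr_of_eventuallyEq (h.mono fun y hy ↦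
      congrArg (TotalSpace.mk' Plane (E := (TangentSpace (𝓡 2) : M → Type _)) y) hy.symm))
    univ_mem h

/-- The Christoffel symbols, as a bilinear map in terms of its values on the basis. -/
def bilinOfBasis (G : Fin 2 → Fin 2 → Plane) : Plane →L[ℝ] Plane →L[ℝ] Plane :=
  ∑ i, ∑ j, (EuclideanSpace.proj (𝕜 := ℝ) i : Plane →L[ℝ] ℝ).smulRight
    ((EuclideanSpace.proj (𝕜 := ℝ) j : Plane →L[ℝ] ℝ).smulRight (G i j))

theorem bilinOfBasis_apply (G : Fin 2 → Fin 2 → Plane) (u v : Plane) :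
    bilinOfBasis G u v = ∑ i, ∑ j, u i • v j • G i j := by
  simp [bilinOfBasis, Fin.sum_univ_two]

theorem form_tangentOfCoord_ne_zero (S : Structure M) {p q : M}
    (hq : q ∈ (chartAt Plane p).source) :
    S.form q (tangentOfCoord p q (EuclideanSpace.single 0 1))
      (tangentOfCoord p q (EuclideanSpace.single 1 1)) ≠ 0 := by
  intro h
  apply S.form_ne_zero q
  ext v z
  rw [← tangentOfCoord_coord hq v, ← tangentOfCoord_coord hq z, form_map, h, zero_mul]
  rfl

/-- The local structure `L` is the expression of `S` in the preferred chart at `p`. -/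
def LocalStructure.Represents (L : LocalStructure) (S : Structure M) (p : M) : Prop :=
  ∀ q ∈ (chartAt Plane p).source, chartAt Plane p q ∈ L.V → ∀ u v : Plane,
    tangentCoord p q (S.conn (fun y ↦ tangentOfCoord p y v) q (tangentOfCoord p q u)) =
      L.Γ (chartAt Plane p q) u v ∧
    S.form q (tangentOfCoord p q u) (tangentOfCoord p q v) = L.w (chartAt Plane p q) * det2 u v

/-- Near every point, an equi-affine structure is given by a local structure in the preferred
chart. -/
theorem Structure.exists_localStructure [T2Space M] (S : Structure M) (p : M) :
    ∃ L : LocalStructure, L.V ⊆ (chartAt Plane p).target ∧ chartAt Plane p p ∈ L.V ∧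
      L.Represents S p := by
  obtain ⟨χ⟩ : Nonempty (SmoothBumpFunction (𝓡 2) p) := inferInstance
  set c := chartAt Plane p with hc
  -- On this open set the global cut-off fields agree locally with the coordinate frame. They are
  -- needed because the parallelism axiom speaks of globally smooth fields.
  set U : Set M := interior {q | χ q = 1} with hU
  have hUn : ∀ q ∈ U, ∀ᶠ y in 𝓝 q, χ y = 1 := fun q hq ↦ mem_interior_iff_mem_nhds.1 hq
  have hbump : ∀ q ∈ U, ∀ v, ∀ᶠ y in 𝓝 q, bumpField χ v y = tangentOfCoord p y v := by
    intro q hq v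
    filter_upwards [hUn q hq] with y hy
    rw [bumpField, hy, one_smul]
  set b : Fin 2 → Plane := fun i ↦ EuclideanSpace.single i 1 with hb
  set G : M → Fin 2 → Fin 2 → Plane := fun q i j ↦
    tangentCoord p q (S.conn (bumpField χ (b j)) q (bumpField χ (b i) q)) with hG
  set W : M → ℝ := fun q ↦ S.form q (bumpField χ (b 0) q) (bumpField χ (b 1) q) with hW
  set V : Set Plane := c.target ∩ c.symm ⁻¹' U with hV
  have hVt : V ⊆ c.target := inter_subset_left
  have hVU : ∀ q ∈ c.source, c q ∈ V → q ∈ U := fun q hq h ↦ by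
    simpa [c.left_inv hq] using h.2
  have hVo : IsOpen V := c.isOpen_inter_preimage_symm isOpen_interior
  have hconn : ∀ q ∈ c.source, q ∈ U → ∀ u v : Plane,
      tangentCoord p q (S.conn (fun y ↦ tangentOfCoord p y v) q (tangentOfCoord p q u)) =
        bilinOfBasis (G q) u v := by
    intro q hq hqU u v
    have hj : ∀ j, S.conn (fun y ↦ tangentOfCoord p y (b j)) q = S.conn (bumpField χ (b j)) q :=
      fun j ↦ conn_congr S (mdifferentiableAt_tangentOfCoord hq _)
        ((hbump q hqU (b j)).mono fun y hy ↦ hy.symm)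
    have hbq : ∀ i, tangentOfCoord p q (b i) = bumpField χ (b i) q :=
      fun i ↦ ((hbump q hqU (b i)).self_of_nhds).symm
    have hcst : MDifferentiableAt (𝓡 2) 𝓘(ℝ, Plane) (fun _ : M ↦ v) q := mdifferentiableAt_const
    rw [conn_tangentOfCoord S hq hcst, mvfderiv_const, zero_apply, map_zero, add_zero]
    have hu : tangentOfCoord p q u = u 0 • bumpField χ (b 0) q + u 1 • bumpField χ (b 1) q := by
      conv_lhs => rw [plane_eq_sum u]
      rw [map_add, map_smul, map_smul, ← hbq 0, ← hbq 1]
    change tangentCoord p q (v 0 • S.conn (fun y ↦ tangentOfCoord p y (b 0)) q _ +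
      v 1 • S.conn (fun y ↦ tangentOfCoord p y (b 1)) q _) = _
    rw [hj 0, hj 1, hu, bilinOfBasis_apply]
    simp only [Fin.sum_univ_two, map_add, map_smul, hG]
    module
  have hform : ∀ q ∈ U, ∀ u v : Plane,
      S.form q (tangentOfCoord p q u) (tangentOfCoord p q v) = W q * det2 u v := by
    intro q hq u v
    rw [← (hbump q hq u).self_of_nhds, ← (hbump q hq v).self_of_nhds]
    exact form_bumpField S χ q u v
  have hW0 : ∀ q ∈ c.source, q ∈ U → W q ≠ 0 := by
    intro q hq hqU
    have := form_tangentOfCoord_ne_zero S hq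
    rwa [← (hbump q hqU _).self_of_nhds, ← (hbump q hqU _).self_of_nhds] at this
  have hWs : ContMDiff (𝓡 2) 𝓘(ℝ, ℝ) ∞ W := contMDiff_form_bumpField S χ (b 0) (b 1)
  have hws : ContDiffOn ℝ ∞ (fun x ↦ W (c.symm x)) V :=
    (contDiffOn_comp_chart_symm hWs.contMDiffOn).mono hVt
  have hGs : ∀ i j, ContDiffOn ℝ ∞ (fun x ↦ G (c.symm x) i j) V := fun i j ↦
    (contDiffOn_comp_chart_symm
      (contMDiffOn_tangentCoord (contMDiff_conn_bumpField S χ (b i) (b j)))).mono hVt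
  have hpar : ∀ q ∈ c.source, c q ∈ V → ∀ u v z : Plane,
      fderiv ℝ (fun x ↦ W (c.symm x)) (c q) u * det2 v z =
        W q * (det2 (bilinOfBasis (G q) u v) z + det2 v (bilinOfBasis (G q) u z)) := by
    intro q hq hqV u v z
    have hqU := hVU q hq hqV
    have h := S.parallel (bumpField χ v) (bumpField χ z) (contMDiff_bumpField χ v)
      (contMDiff_bumpField χ z) q (tangentOfCoord p q u)
    have hv : S.conn (bumpField χ v) q = S.conn (fun y ↦ tangentOfCoord p y v) q :=
      (conn_congr S (mdifferentiableAt_tangentOfCoord hq _)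
        ((hbump q hqU v).mono fun y hy ↦ hy.symm)).symm
    have hz : S.conn (bumpField χ z) q = S.conn (fun y ↦ tangentOfCoord p y z) q :=
      (conn_congr S (mdifferentiableAt_tangentOfCoord hq _)
        ((hbump q hqU z).mono fun y hy ↦ hy.symm)).symm
    rw [hv, hz, (hbump q hqU v).self_of_nhds, (hbump q hqU z).self_of_nhds,
      ← tangentOfCoord_coord hq (S.conn (fun y ↦ tangentOfCoord p y v) q _),
      ← tangentOfCoord_coord hq (S.conn (fun y ↦ tangentOfCoord p y z) q _),
      hconn q hq hqU, hconn q hq hqU, hform q hqU, hform q hqU] at h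
    rw [mul_add, ← h]
    have hfun : (fun y ↦ S.form y (bumpField χ v y) (bumpField χ z y)) = fun y ↦ W y * det2 v z :=
      funext fun y ↦ form_bumpField S χ y v z
    have hwd : HasFDerivAt (fun x ↦ W (c.symm x)) (fderiv ℝ (fun x ↦ W (c.symm x)) (c q)) (c q) :=
      ((hws.contDiffAt (hVo.mem_nhds hqV)).differentiableAt (by simp)).hasFDerivAt
    have hφ : HasMFDerivAt (𝓡 2) 𝓘(ℝ, Plane) c q (mfderiv (𝓡 2) 𝓘(ℝ, Plane) c q) :=
      (mdifferentiableAt_atlas (chart_mem_atlas Plane p) hq).hasMFDerivAt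
    have hwc := (hwd.mul_const (det2 v z)).hasMFDerivAt.comp q hφ
    have he : (fun y ↦ W y * det2 v z) =ᶠ[𝓝 q]
        (fun x ↦ W (c.symm x) * det2 v z) ∘ c := by
      filter_upwards [chart_source_mem_nhds hq] with y hy
      simp only [Function.comp, hc, (chartAt Plane p).left_inv hy]
    have hm := (hwc.congr_of_eventuallyEq he).mfderiv
    have hcu : (mfderiv (𝓡 2) 𝓘(ℝ, Plane) c q) (tangentOfCoord p q u) = u :=
      (mfderiv_extChartAt_eq_tangentCoord hq _).trans (tangentCoord_ofCoord hq u)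
    rw [hfun, mvfderiv, ContinuousLinearMap.comp_apply, hm]
    change _ = (det2 v z • fderiv ℝ (fun x ↦ W (c.symm x)) (c q))
      ((mfderiv (𝓡 2) 𝓘(ℝ, Plane) c q) (tangentOfCoord p q u))
    rw [hcu, smul_apply, smul_eq_mul, mul_comm]
  refine ⟨⟨V, hVo, fun x ↦ bilinOfBasis (G (c.symm x)), ?_, fun x ↦ W (c.symm x), hws, ?_, ?_⟩,
    hVt, ?_, ?_⟩
  · refine contDiffOn_clm_apply.2 fun u ↦ contDiffOn_clm_apply.2 fun v ↦ ?_
    simp only [bilinOfBasis_apply]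
    exact ContDiffOn.sum fun i _ ↦ ContDiffOn.sum fun j _ ↦
      ((hGs i j).const_smul (v j)).const_smul (u i)
  · exact fun x hx ↦ hW0 _ (c.map_target hx.1) hx.2
  · intro x hx u v z
    have := hpar _ (c.map_target hx.1) (by rwa [c.right_inv hx.1]) u v z
    rwa [c.right_inv hx.1] at this
  · refine ⟨mem_chart_target _ _, ?_⟩
    change c.symm (c p) ∈ U
    rw [c.left_inv (mem_chart_source _ _)]
    exact mem_interior_iff_mem_nhds.2 χ.eventuallyEq_one
  · intro q hq hqV u v
    have e : c.symm (chartAt Plane p q) = q := c.left_inv hq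
    simp only [e]
    exact ⟨hconn q hq (hVU q hq hqV) u v, hform q (hVU q hq hqV) u v⟩

/-! ### Transfer of jets, brackets and curvature between chart and surface. -/

namespace LocalStructure.Represents

variable {L : LocalStructure} {S : Structure M} {p : M} {γ : ℝ → M} {x : ℝ → Plane} {δ : ℝ}

theorem contDiffOn_coord (hγ : ContMDiffOn 𝓘(ℝ, ℝ) (𝓡 2) ∞ γ (Ioo (-δ) δ))
    (hs : MapsTo γ (Ioo (-δ) δ) (chartAt Plane p).source)
    (hx : ∀ t ∈ Ioo (-δ) δ, chartAt Plane p (γ t) = x t) : ContDiffOn ℝ ∞ x (Ioo (-δ) δ) := by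
  have h : ContMDiffOn 𝓘(ℝ, ℝ) 𝓘(ℝ, Plane) ∞ (chartAt Plane p ∘ γ) (Ioo (-δ) δ) :=
    (contMDiffOn_chart (I := 𝓡 2)).comp hγ hs
  exact (contMDiffOn_iff_contDiffOn.1 h).congr fun t ht ↦ (hx t ht).symm

theorem tangentCoord_velocity {t : ℝ} (hγ : MDifferentiableAt 𝓘(ℝ, ℝ) (𝓡 2) γ t)
    (hs : γ t ∈ (chartAt Plane p).source) (hx : ∀ᶠ s in 𝓝 t, chartAt Plane p (γ s) = x s) :
    tangentCoord p (γ t) (velocity γ t) = deriv x t := by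
  have h := hasDerivAt_comp_curve (mdifferentiableAt_extChartAt (I := 𝓡 2) hs) hγ
  rw [mfderiv_extChartAt_eq_tangentCoord hs] at h
  have hx' : x =ᶠ[𝓝 t] fun s ↦ extChartAt (𝓡 2) p (γ s) := hx.mono fun s hs ↦ hs.symm
  rw [hx'.deriv_eq, h.deriv]

/-- `covAlong` uses the chart centred at γ(t), which moves with t. By `tangentCoord_covAlong` the
fixed chart at p may be used throughout, so the two recursions coincide. -/
theorem tangentCoord_jet (hL : L.Represents S p) (hγ : ContMDiffOn 𝓘(ℝ, ℝ) (𝓡 2) ∞ γ (Ioo (-δ) δ))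
    (hs : MapsTo γ (Ioo (-δ) δ) (chartAt Plane p).source)
    (hx : ∀ t ∈ Ioo (-δ) δ, chartAt Plane p (γ t) = x t) (hV : MapsTo x (Ioo (-δ) δ) L.V)
    (k : ℕ) {t : ℝ} (ht : t ∈ Ioo (-δ) δ) :
    tangentCoord p (γ t) (S.jet γ k t) = L.jet x k t := by
  have hγd : ∀ t ∈ Ioo (-δ) δ, MDifferentiableAt 𝓘(ℝ, ℝ) (𝓡 2) γ t := fun t ht ↦
    (hγ.contMDiffAt (isOpen_Ioo.mem_nhds ht)).mdifferentiableAt (by simp)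
  have hvel : ∀ t ∈ Ioo (-δ) δ, tangentCoord p (γ t) (velocity γ t) = deriv x t := fun t ht ↦
    tangentCoord_velocity (hγd t ht) (hs ht)
      (Filter.mem_of_superset (isOpen_Ioo.mem_nhds ht) hx)
  induction k generalizing t with
  | zero => exact hvel t ht
  | succ k ih =>
    have e : (fun s ↦ tangentCoord p (γ s) (S.jet γ k s)) =ᶠ[𝓝 t] L.jet x k :=
      Filter.mem_of_superset (isOpen_Ioo.mem_nhds ht) fun s hs ↦ ih hs
    have hd := ContDiffOn.hasDerivAt_of_Ioo (by simp)
      (contDiffOn_jet (contDiffOn_coord hγ hs hx) hV k) ht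
    have hvel' : velocity γ t = tangentOfCoord p (γ t) (deriv x t) := by
      rw [← hvel t ht, tangentOfCoord_coord (hs ht)]
    change tangentCoord p (γ t) (S.covAlong γ (S.jet γ k) t) = _
    rw [tangentCoord_covAlong S (hs ht) (hγd t ht) (hd.differentiableAt.congr_of_eventuallyEq e),
      e.deriv_eq, ih ht, hvel', (hL (γ t) (hs ht) (by rw [hx t ht]; exact hV ht) _ _).1, hx t ht,
      jet_succ]

theorem bracket_eq (hL : L.Represents S p) (hγ : ContMDiffOn 𝓘(ℝ, ℝ) (𝓡 2) ∞ γ (Ioo (-δ) δ))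
    (hs : MapsTo γ (Ioo (-δ) δ) (chartAt Plane p).source)
    (hx : ∀ t ∈ Ioo (-δ) δ, chartAt Plane p (γ t) = x t) (hV : MapsTo x (Ioo (-δ) δ) L.V)
    (i j : ℕ) {t : ℝ} (ht : t ∈ Ioo (-δ) δ) :
    S.bracket γ (i + 1) (j + 1) t = L.bracket x i j t := by
  have hi := tangentCoord_jet hL hγ hs hx hV i ht
  have hj := tangentCoord_jet hL hγ hs hx hV j ht
  have hc : chartAt Plane p (γ t) ∈ L.V := by rw [hx t ht]; exact hV ht
  rw [Structure.bracket, Nat.add_sub_cancel, Nat.add_sub_cancel,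
    ← tangentOfCoord_coord (hs ht) (S.jet γ i t), ← tangentOfCoord_coord (hs ht) (S.jet γ j t),
    hi, hj, (hL (γ t) (hs ht) hc _ _).2, hx t ht]
  rfl

theorem normalizedCurvature_eq (hL : L.Represents S p) (hγ : ContMDiffOn 𝓘(ℝ, ℝ) (𝓡 2) ∞ γ (Ioo (-δ) δ))
    (hs : MapsTo γ (Ioo (-δ) δ) (chartAt Plane p).source)
    (hx : ∀ t ∈ Ioo (-δ) δ, chartAt Plane p (γ t) = x t) (hV : MapsTo x (Ioo (-δ) δ) L.V)
    (hδ : 0 < δ) {H : ℝ → ℝ} (hH : ContDiffOn ℝ ∞ H (Ioo (-δ) δ))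
    (h : ∀ t ∈ Ioo (-δ) δ, t ≠ 0 →
      normalizedQuotient (L.bracket x 0 1) (L.bracket x 0 2) (L.bracket x 0 3)
        (L.bracket x 1 2) t = -5 / 16 + t * H t) {t : ℝ} (ht : t ∈ Ioo (-δ) δ) :
    S.normalizedCurvature γ t = -5 / 16 + t * H t := by
  have hz : (0 : ℝ) ∈ Ioo (-δ) δ := by simpa using hδ
  have hB := fun i j t ht ↦ bracket_eq hL hγ hs hx hV i j (t := t) ht
  have key : ∀ t ∈ Ioo (-δ) δ, t ≠ 0 →
      S.arclength γ t ^ 2 * S.curvature γ t = -5 / 16 + t * H t := by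
    intro t ht ht0
    rw [← h t ht ht0, normalizedQuotient, Structure.curvature, Structure.arclength,
      ← hB 0 1 t ht, ← hB 0 2 t ht, ← hB 0 3 t ht, ← hB 1 2 t ht]
    congr 2
    refine intervalIntegral.integral_congr fun u hu ↦ ?_
    rw [← hB 0 1 u (ordConnected_Ioo.uIcc_subset hz ht hu)]
  by_cases ht0 : t = 0
  · subst ht0
    rw [Structure.normalizedCurvature, Function.update_self]
    -- The value at 0 is defined as a limit, which continuity of -5/16 + t H identifies.
    apply Tendsto.limUnder_eq
    have hc : ContinuousAt (fun t ↦ -5 / 16 + t * H t) 0 :=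
      continuousAt_const.add (continuousAt_id.mul
        (hH.continuousOn.continuousAt (isOpen_Ioo.mem_nhds hz)))
    refine (hc.tendsto.mono_left nhdsWithin_le_nhds).congr' ?_
    filter_upwards [self_mem_nhdsWithin, nhdsWithin_le_nhds (isOpen_Ioo.mem_nhds hz)] with s h1 h2
    exact (key s h2 h1).symm
  · rw [Structure.normalizedCurvature, Function.update_of_ne ht0]
    exact key t ht ht0

end LocalStructure.Represents

/-- The normalized affine curvature function at a generic inflection point. -/
theorem Structure.IsGenericInflection.exists_smooth_normalizedCurvature [T2Space M]
    {S : Structure M} {γ : ℝ → M} (h : S.IsGenericInflection γ) :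
    ∃ δ > 0, ∃ H : ℝ → ℝ, ContDiffOn ℝ ∞ H (Ioo (-δ) δ) ∧
      (∀ t ∈ Ioo (-δ) δ, S.normalizedCurvature γ t = -5 / 16 + t * H t) ∧
      (H 0 = 0 → deriv H 0 = 0) := by
  obtain ⟨δ₀, hδ₀, hγ₀⟩ := h.smooth
  obtain ⟨L, -, hmem, hL⟩ := S.exists_localStructure (γ 0)
  set c := chartAt Plane (γ 0) with hc
  have hz₀ : (0 : ℝ) ∈ Ioo (-δ₀) δ₀ := by simpa using hδ₀
  have hcont : ContinuousAt γ 0 := hγ₀.continuousOn.continuousAt (isOpen_Ioo.mem_nhds hz₀)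
  have hn : c.source ∩ c ⁻¹' L.V ∈ 𝓝 (γ 0) :=
    (c.isOpen_inter_preimage L.isOpen).mem_nhds ⟨mem_chart_source _ _, hmem⟩
  obtain ⟨δ, hδ, hle, hsub⟩ := exists_Ioo_symm_subset (hcont.preimage_mem_nhds hn) hδ₀
  have hγ := hγ₀.mono (Ioo_symm_subset hle)
  have hs : MapsTo γ (Ioo (-δ) δ) c.source := fun t ht ↦ (hsub ht).1
  have hV : MapsTo (fun t ↦ c (γ t)) (Ioo (-δ) δ) L.V := fun t ht ↦ (hsub ht).2
  have hx : ∀ t ∈ Ioo (-δ) δ, c (γ t) = c (γ t) := fun _ _ ↦ rfl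
  set x : ℝ → Plane := fun t ↦ c (γ t)
  have sx : ContDiffOn ℝ ∞ x (Ioo (-δ) δ) :=
    LocalStructure.Represents.contDiffOn_coord hγ hs hx
  have hz : (0 : ℝ) ∈ Ioo (-δ) δ := by simpa using hδ
  have hB := fun i j t ht ↦ hL.bracket_eq hγ hs hx hV i j (t := t) ht
  have hb0 : L.bracket x 0 1 0 = 0 := (hB 0 1 0 hz).symm.trans h.inflection
  have hpl := LocalStructure.bracket_plucker (L := L) (x := x) 0 1 2 3 0
  obtain ⟨δ', hδ', H, hH, hq, hH0⟩ := exists_smooth_normalizedQuotient hδ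
    (b12 := L.bracket x 0 1) (b13 := L.bracket x 0 2) (b14 := L.bracket x 0 3)
    (b23 := L.bracket x 1 2) (b24 := L.bracket x 1 3)
    (LocalStructure.contDiffOn_bracket sx hV 0 1) (LocalStructure.contDiffOn_bracket sx hV 1 2)
    (fun t ht ↦ (LocalStructure.hasDerivAt_bracket sx hV 0 1 ht).congr_deriv
      (by rw [LocalStructure.bracket_self, zero_add]))
    (fun t ht ↦ LocalStructure.hasDerivAt_bracket sx hV 0 2 ht)
    ((LocalStructure.hasDerivAt_bracket sx hV 1 2 hz).congr_deriv
      (by rw [LocalStructure.bracket_self, zero_add]))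
    -- The Plücker relation loses its first product because [γ̇, γ̈] vanishes at 0.
    (by rw [hb0] at hpl; linarith) hb0
    (by rw [← hB 0 2 0 hz]; exact h.generic)
  have h1 := Ioo_symm_subset (min_le_left δ δ')
  have h2 := Ioo_symm_subset (min_le_right δ δ')
  exact ⟨min δ δ', lt_min hδ hδ', H, hH.mono h2, fun t ht ↦
    hL.normalizedCurvature_eq (hγ.mono h1) (hs.mono_left h1) (fun _ _ ↦ rfl) (hV.mono_left h1)
      (lt_min hδ hδ') (hH.mono h2) (fun t ht ↦ hq t (h2 ht)) ht, hH0⟩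

theorem Structure.exists_isGenericInflection [T2Space M] [Nonempty M] (S : Structure M) {δ : ℝ}
    (hδ : 0 < δ) {H : ℝ → ℝ} (hH : ContDiffOn ℝ ∞ H (Ioo (-δ) δ))
    (h0 : H 0 ≠ 0 ∨ (H 0 = 0 ∧ deriv H 0 = 0)) :
    ∃ γ : ℝ → M, S.IsGenericInflection γ ∧ ∃ δ' > 0,
      ∀ t ∈ Ioo (-δ') δ', S.normalizedCurvature γ t = -5 / 16 + t * H t := by
  obtain ⟨p⟩ := ‹Nonempty M›
  obtain ⟨L, hVt, hmem, hL⟩ := S.exists_localStructure p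
  obtain ⟨δ', hδ', hle, x, -, sx, hV, hx', hb1, hb2, hq⟩ :=
    L.exists_curve_normalizedQuotient hmem hδ hH h0
  set c := chartAt Plane p with hc
  have hz : (0 : ℝ) ∈ Ioo (-δ') δ' := by simpa using hδ'
  have ht : MapsTo x (Ioo (-δ') δ') c.target := fun t ht ↦ hVt (hV ht)
  have hγ : ContMDiffOn 𝓘(ℝ, ℝ) (𝓡 2) ∞ (fun t ↦ c.symm (x t)) (Ioo (-δ') δ') :=
    (contMDiffOn_chart_symm (I := 𝓡 2)).comp (contMDiffOn_iff_contDiffOn.2 sx) ht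
  have hs : MapsTo (fun t ↦ c.symm (x t)) (Ioo (-δ') δ') c.source :=
    fun t h ↦ c.map_target (ht h)
  have hx : ∀ t ∈ Ioo (-δ') δ', c (c.symm (x t)) = x t := fun t h ↦ c.right_inv (ht h)
  have hB := fun i j t ht ↦ hL.bracket_eq hγ hs hx hV i j (t := t) ht
  refine ⟨fun t ↦ c.symm (x t), ⟨⟨δ', hδ', hγ⟩, ?_, (hB 0 1 0 hz).trans hb1, ?_⟩, δ', hδ',
    fun t ht ↦ hL.normalizedCurvature_eq hγ hs hx hV hδ' (hH.mono (Ioo_symm_subset hle)) hq ht⟩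
  · intro hv
    apply hx'
    rw [← LocalStructure.Represents.tangentCoord_velocity (p := p)
      ((hγ.contMDiffAt (isOpen_Ioo.mem_nhds hz)).mdifferentiableAt (by simp)) (hs hz)
      (Filter.mem_of_superset (isOpen_Ioo.mem_nhds hz) hx), hv, map_zero]
  · exact fun h ↦ hb2 ((hB 0 2 0 hz).symm.trans h)

end EquiAffine

end

/-! ### The image of the normalized curvature map on germs. -/

theorem corollary4p8 {M : Type*} [TopologicalSpace M] [T2Space M] [Nonempty M]
    [ChartedSpace (EuclideanSpace ℝ (Fin 2)) M] [IsManifold (𝓡 2) ∞ M]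
    (S : EquiAffine.Structure M) :
    S.normalizedCurvatureGerm '' S.inflectionGerms =
      {φ : Germ (𝓝 (0 : ℝ)) ℝ | ∃ f : ℝ → ℝ, (f : Germ (𝓝 (0 : ℝ)) ℝ) = φ ∧
        EquiAffine.SmoothNearZero f ∧ f 0 = -5 / 16 ∧ deriv f 0 ≠ 0} ∪
      {φ : Germ (𝓝 (0 : ℝ)) ℝ | ∃ f : ℝ → ℝ, (f : Germ (𝓝 (0 : ℝ)) ℝ) = φ ∧
        EquiAffine.SmoothNearZero f ∧ f 0 = -5 / 16 ∧ deriv f 0 = 0 ∧ iteratedDeriv 2 f 0 = 0} := by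
  have hreal : ∀ f : ℝ → ℝ, EquiAffine.SmoothNearZero f → f 0 = -5 / 16 →
      (deriv f 0 ≠ 0 ∨ (deriv f 0 = 0 ∧ iteratedDeriv 2 f 0 = 0)) →
      (f : Germ (𝓝 (0 : ℝ)) ℝ) ∈ S.normalizedCurvatureGerm '' S.inflectionGerms := by
    rintro f ⟨δ, hδ, hf⟩ hf0 hd
    -- Hadamard's lemma writes f = -5/16 + t H, which turns the conditions on f into the solvability
    -- conditions on H(0) and H'(0).
    obtain ⟨H, hH, hfH⟩ := EquiAffine.exists_smooth_eq_mul
      (g := fun t ↦ f t - (-5 / 16)) (hf.sub contDiffOn_const) (sub_eq_zero.2 hf0)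
    have hfH' : ∀ t ∈ Ioo (-δ) δ, f t = -5 / 16 + t * H t := fun t ht ↦ by
      linarith [hfH t ht]
    obtain ⟨h1, h2⟩ := EquiAffine.deriv_zero_of_eq_add_mul hδ hH hfH'
    rw [h1, h2] at hd
    obtain ⟨γ, hγ, δ', hδ', hγf⟩ := S.exists_isGenericInflection hδ hH
      (hd.imp_right fun h ↦ ⟨h.1, by linarith [h.2]⟩)
    refine ⟨γ, ⟨γ, rfl, hγ⟩, Germ.coe_eq.2 ?_⟩
    filter_upwards [Ioo_mem_nhds (neg_lt_zero.2 hδ') hδ', Ioo_mem_nhds (neg_lt_zero.2 hδ) hδ]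
      with t h h'
    rw [hγf t h, hfH' t h']
  ext φ
  constructor
  · rintro ⟨_, ⟨γ, rfl, hγ⟩, rfl⟩
    obtain ⟨δ, hδ, H, hH, hγH, hH0⟩ := hγ.exists_smooth_normalizedCurvature
    obtain ⟨h1, h2⟩ := EquiAffine.deriv_zero_of_eq_add_mul (F := fun t ↦ -5 / 16 + t * H t) hδ hH
      fun _ _ ↦ rfl
    have hgerm : ((fun t ↦ -5 / 16 + t * H t : ℝ → ℝ) : Germ (𝓝 (0 : ℝ)) ℝ) =
        S.normalizedCurvatureGerm γ := by
      refine Germ.coe_eq.2 ?_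
      filter_upwards [Ioo_mem_nhds (neg_lt_zero.2 hδ) hδ] with t ht
      exact (hγH t ht).symm
    have hsm : EquiAffine.SmoothNearZero fun t ↦ -5 / 16 + t * H t :=
      ⟨δ, hδ, contDiffOn_const.add (contDiffOn_id.mul hH)⟩
    by_cases h : H 0 = 0
    · exact Or.inr ⟨_, hgerm, hsm, by simp, h1.trans h, by rw [h2, hH0 h, mul_zero]⟩
    · exact Or.inl ⟨_, hgerm, hsm, by simp, by rwa [h1]⟩
  · rintro (⟨f, rfl, hf, hf0, hd⟩ | ⟨f, rfl, hf, hf0, hd⟩)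
    · exact hreal f hf hf0 (Or.inl hd)
    · exact hreal f hf hf0 (Or.inr hd)
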